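/- Let $0<q<1$ and $0<\xi<1$. For a partition $\lambda=(\lambda_1\ge\lambda_2\ge\cdots)$ put $|\lambda|=\sum_i\lambda_i$, $b(\lambda)=\sum_{i\ge1}(i-1)\lambda_i$, and for a cell $(i,j)\in\lambda$ let $h(i,j)=\lambda_i+\lambda^{\mathrm T}_j-i-j+1$ be its hook length, where $\lambda^{\mathrm T}$ is the transposed partition. The squared type $q$-Plancherel measure is the measure on the set of all partitions with weights $$\mu[\lambda]=M(\xi;q)^{-1}(\xi^2q)^{|\lambda|}q^{2b(\lambda)}\prod_{(i,j)\in\lambda}\frac{1}{(1-q^{h(i,j)})^2},\qquad M(\xi;q)=\prod_{n\ge1}\frac{1}{(1-\xi^2q^n)^n}.$$ It is a probability measure, and the random point configuration $\Xi(\lambda)=\{\lambda_i-i+\tfrac12 : i\ge1\}\subset\mathbb Z+\tfrac12$ is a determinantal point process: for every $k\ge0$ and all distinct $z_1,\dots,z_k\in\mathbb Z+\tfrac12$, $$\mu\bigl[\{\lambda : \{z_1,\dots,z_k\}\subset\Xi(\lambda)\}\bigr]=\det_{1\le i,j\le k}K(z_i,z_j).$$ Here $K$ is the $q$-Bessel kernel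 $$K(r,s)=\xi\,\frac{J_{r+\frac12}J_{s-\frac12}-J_{r-\frac12}J_{s+\frac12}}{q^{\frac12(r-s)}-q^{-\frac12(r-s)}},\qquad r\ne s,$$ and on the diagonal $K(r,r)=\lim_{s\to r}K(r,s)$, where $s\ne r$ runs through real numbers and the limit exists. For real $\nu$, $J_\nu=J^{(3)}_\nu(2\xi;q)$ is the Hahn--Exton $q$-Bessel function $$J^{(3)}_\nu(x;q)=\frac{(q^{\nu+1};q)_\infty}{(q;q)_\infty}\Bigl(\frac x2\Bigr)^{\nu}\sum_{m\ge0}\frac{(-1)^mq^{\binom m2}}{(q;q)_m(q^{\nu+1};q)_m}\Bigl(\frac{qx^2}{4}\Bigr)^m,$$ where $(a;q)_m=\prod_{k=0}^{m-1}(1-aq^k)$ and $(a;q)_\infty=\prod_{k\ge0}(1-aq^k)$, and where at negative integers $\nu$ the formula is extended by continuity, i.e. $(q^{\nu+1};q)_\infty/(q^{\nu+1};q)_m$ is read as $(q^{\nu+1+m};q)_\infty$. -/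

import Mathlib

open Filter Topology MeasureTheory

noncomputable section

namespace QPlancherel

/-! ### `q`-functions -/

/-- The finite `q`-shifted factorial `(x; q)_n = ∏_{k < n} (1 - x q^k)`. -/
def qPoch (x q : ℝ) (n : ℕ) : ℝ := ∏ k ∈ Finset.range n, (1 - x * q ^ k)

/-- The infinite `q`-shifted factorial `(x; q)_∞ = ∏_{k ≥ 0} (1 - x q^k)`. -/
def qPochInf (x q : ℝ) : ℝ := ∏' k : ℕ, (1 - x * q ^ k)

/-- The modified MacMahon function `M(ξ; q) = ∏_{n ≥ 1} (1 - ξ² q^n)^{-n}`. -/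
def macMahon (ξ q : ℝ) : ℝ := ∏' n : ℕ, (1 / (1 - ξ ^ 2 * q ^ (n + 1)) ^ (n + 1))

/-- The basic hypergeometric series `₁φ₁(a; b; q, x)`. -/
def phi11 (a b q x : ℝ) : ℝ :=
  ∑' m : ℕ, qPoch a q m / (qPoch q q m * qPoch b q m) *
    ((-1) ^ m * q ^ m.choose 2) * x ^ m

/-- The Hahn–Exton (third Jackson) `q`-Bessel function of real order `ν`,
`J_ν^{(3)}(x; q) = (q^{ν+1}; q)_∞ / (q; q)_∞ (x/2)^ν ₁φ₁(0; q^{ν+1}; q, q x²/4)`.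
The factor `(q^{ν+1}; q)_∞` is multiplied into the series, where
`(q^{ν+1}; q)_∞ / (q^{ν+1}; q)_m = (q^{ν+1+m}; q)_∞`. In this way the negative integers `ν`, at which
the product above reads `0 · ∞`, are covered by continuity, as usual;
see `hahnExton_eq_phi11` for the other `ν`. -/
def hahnExton (ν x q : ℝ) : ℝ :=
  (x / 2) ^ ν * ∑' m : ℕ, qPochInf (q ^ (ν + 1 + m)) q / (qPochInf q q * qPoch q q m) *
    ((-1) ^ m * q ^ m.choose 2) * (q * x ^ 2 / 4) ^ m

/-- Off the negative integers, `hahnExton` is given by the hypergeometric formula. -/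
theorem hahnExton_eq_phi11 (ν x q : ℝ) (hq : 0 < q) (hq1 : q < 1)
    (hν : ∀ k : ℕ, ν ≠ -((k : ℝ) + 1)) :
    hahnExton ν x q = qPochInf (q ^ (ν + 1)) q / qPochInf q q * (x / 2) ^ ν *
      phi11 0 (q ^ (ν + 1)) q (q * x ^ 2 / 4) := by
  have hne : ∀ k : ℕ, 1 - q ^ (ν + 1) * q ^ k ≠ 0 := by
    intro k h
    have h1 : q ^ (ν + 1 + k) = 1 := by
      rw [Real.rpow_add hq, Real.rpow_natCast]; linarith
    have h2 : (ν + 1 + k) * Real.log q = 0 := by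
      rw [← Real.log_rpow hq, h1, Real.log_one]
    rcases mul_eq_zero.1 h2 with h3 | h3
    · exact hν k (by linarith)
    · exact (Real.log_neg hq hq1).ne h3
  have hsplit : ∀ m : ℕ, qPochInf (q ^ (ν + 1)) q =
      qPoch (q ^ (ν + 1)) q m * qPochInf (q ^ (ν + 1 + m)) q := by
    intro m
    have hterm : ∀ k : ℕ, 1 - q ^ (ν + 1) * q ^ (k + m) = 1 - q ^ (ν + 1 + m) * q ^ k := by
      intro k
      rw [Real.rpow_add hq (ν + 1) m, Real.rpow_natCast]; ring
    have hmul : Multipliable fun k : ℕ => 1 - q ^ (ν + 1) * q ^ (k + m) := by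
      simp only [hterm, sub_eq_add_neg]
      refine multipliable_one_add_of_summable ?_
      refine Summable.congr (f := fun k : ℕ => |q ^ (ν + 1 + m)| * q ^ k)
        ((summable_geometric_of_lt_one hq.le hq1).mul_left _) ?_
      intro k
      rw [norm_neg, norm_mul, Real.norm_eq_abs, Real.norm_eq_abs, abs_of_pos (pow_pos hq k)]
    have h := Multipliable.prod_mul_tprod_nat_mul'
      (f := fun k : ℕ => 1 - q ^ (ν + 1) * q ^ k) hmul
    simp only [hterm] at h
    exact h.symm
  unfold hahnExton phi11
  rw [← tsum_mul_left, ← tsum_mul_left]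
  refine tsum_congr fun m => ?_
  have h0 : qPoch 0 q m = 1 := by simp [qPoch]
  have hm : qPoch (q ^ (ν + 1)) q m ≠ 0 := Finset.prod_ne_zero_iff.2 fun k _ => hne k
  rw [h0, hsplit m]
  field_simp

/-! ### Half-integers, partitions and the squared type `q`-Plancherel measure -/

/-- The lattice `ℤ' = ℤ + 1/2`. -/
def halfIntegers : Set ℝ := {x | ∃ n : ℤ, x = n + 1 / 2}

/-- `b(λ) = ∑_{i ≥ 1} (i - 1) λ_i`; row `i` of a Young diagram is counted from `0`. -/
def bStat (lam : YoungDiagram) : ℕ := ∑ i ∈ Finset.range (lam.colLen 0), i * lam.rowLen i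

/-- The hook length `h(i, j) = λ_i + λᵀ_j - i - j + 1` of a cell, in coordinates counted from `0`. -/
def hook (lam : YoungDiagram) (c : ℕ × ℕ) : ℕ := lam.rowLen c.1 + lam.colLen c.2 - c.1 - c.2 - 1

/-- The weight
`M(ξ; q)⁻¹ (ξ² q)^{|λ|} q^{2 b(λ)} ∏_{(i,j) ∈ λ} (1 - q^{h(i,j)})^{-2}` of a partition. -/
def weight (ξ q : ℝ) (lam : YoungDiagram) : ℝ :=
  (macMahon ξ q)⁻¹ * (ξ ^ 2 * q) ^ lam.card * q ^ (2 * bStat lam) *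
    ∏ c ∈ lam.cells, 1 / (1 - q ^ hook lam c) ^ 2

/-- All sets of partitions are measurable. -/
instance : MeasurableSpace YoungDiagram := ⊤

/-- The squared type `q`-Plancherel measure on the set of all partitions. -/
def measureS (ξ q : ℝ) : Measure YoungDiagram :=
  Measure.sum fun lam => ENNReal.ofReal (weight ξ q lam) • Measure.dirac lam

/-- The point configuration `Ξ(λ) = {λ_i - i + 1/2 : i ≥ 1}`, with `i` counted from `0` here. -/
def config (lam : YoungDiagram) : Set ℝ := {x | ∃ i : ℕ, x = (lam.rowLen i : ℝ) - (i + 1) + 1 / 2}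

/-- The correlation function `ρ(Z) = ℙ[Z ⊆ Ξ(λ)]` of a random partition with law `P`. -/
def correlation (P : Measure YoungDiagram) (Z : Set ℝ) : ℝ := P.real {lam | Z ⊆ config lam}

/-! ### The `q`-Bessel kernel -/

/-- The expression
`ξ (J_{r+1/2} J_{s-1/2} - J_{r-1/2} J_{s+1/2}) / (q^{(r-s)/2} - q^{-(r-s)/2})`, `J_ν = J_ν^{(3)}(2ξ; q)`,
for real `r ≠ s`. -/
def kernelQuotient (ξ q r s : ℝ) : ℝ :=
  ξ * (hahnExton (r + 1 / 2) (2 * ξ) q * hahnExton (s - 1 / 2) (2 * ξ) q -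
      hahnExton (r - 1 / 2) (2 * ξ) q * hahnExton (s + 1 / 2) (2 * ξ) q) /
    (q ^ ((r - s) / 2) - q ^ (-((r - s) / 2)))

open Classical in
/-- The `q`-Bessel kernel: the quotient above for `r ≠ s`, and its limit as `s → r` through real
`s ≠ r` on the diagonal, where the quotient reads `0 / 0`. -/
def qBesselKernel (ξ q r s : ℝ) : ℝ :=
  if r = s then limUnder (𝓝[≠] r) (fun u : ℝ => kernelQuotient ξ q r u)
  else kernelQuotient ξ q r s

end QPlancherel

end

/-! Only the partitions with at most `N` rows are considered first. Through `p_j = λ_{N-j} + j`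
(rows counted from 1, `j` from 0) they become increasing `N`-tuples of natural numbers. With `c = ξ
√q` and `a_i = c q^i`, the determinant `det (a_i ^ p_j)` is essentially a Vandermonde determinant in
the `q ^ p_j`. The hook identity `prod_hook_row` shows that its square is a constant times the
unnormalized weight of `λ` times `rowRatio`, a correction in `[0, 1]` that tends to 1 as `N → ∞`
(`powDet_sq_shiftedRows`).

For squared determinants everything is computable. By Cauchy–Binet the total mass is the determinant
of the Gram matrix `G = (1 / (1 - a_i a_j))`. Marking the points of `z` by a variable `t` perturbs
`G` by `(t - 1) Φ Φᵀ`, and the top coefficient in `t` gives the correlations as `k × k` determinants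
of `Φᵀ G⁻¹ Φ` (`hasSum_powDet_sq_of_range_subset`). Lagrange interpolation gives `G⁻¹ = D G D` with
`D` diagonal (`sum_cauchyCoeff`). Expanding the entries of `G` in this inverse as geometric series
writes the kernel as a sum over `l` of products of two one-variable sums (`sum_cauchyGram_inv`).

As `N → ∞` these sums converge to `q ^ (ν / 2) J_ν`. To see this, the Hahn–Exton function is
rewritten as a power series in `q ^ ν`, by a symmetry of the double series that Euler's expansion
produces (`tsum_besselCoeff_symm`). The limiting kernel `∑_l q ^ ((ν + μ) / 2 + l) J_{ν + l} J_{μ +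
l}`, with `ν = r + 1/2` and `μ = s + 1/2`, is the quotient form of the `q`-Bessel kernel: the
three-term recurrence makes it telescope, as in the Christoffel–Darboux formula
(`kernelQuotient_eq_kernelSeries`). The series is also continuous up to the diagonal, which gives
the limits there.

The normalizations `∏_{i, j < N} (1 - ξ² q^{i+j+1})⁻¹` converge to the MacMahon product. This bounds
the sums of the unnormalized weights, which then serve as a dominating function for passing to the
limit in the correlations (`hasSum_rawWeight_config`). The case `k = 0` is the normalization of the
measure. -/

noncomputable section

namespace QPlancherel

/-! ### Determinants -/

/-- The Cauchy–Binet formula, as a sum over increasing tuples. -/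
theorem det_sum_mul_eq_sum_strictMono {R α : Type*} [CommRing R] [LinearOrder α] {N : ℕ}
    (S : Finset α) (f g : Fin N → α → R) [DecidablePred fun p : Fin N → α => StrictMono p] :
    Matrix.det (Matrix.of fun i j => ∑ x ∈ S, f i x * g j x) =
      ∑ p ∈ (Fintype.piFinset fun _ : Fin N => S).filter StrictMono,
        Matrix.det (Matrix.of fun i j => f i (p j)) *
          Matrix.det (Matrix.of fun i j => g i (p j)) := by
  classical
  have h1 : Matrix.det (Matrix.of fun i j => ∑ x ∈ S, f i x * g j x) =
      ∑ p ∈ Fintype.piFinset fun _ : Fin N => S,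
        (∏ i, g i (p i)) * Matrix.det (Matrix.of fun i j => f i (p j)) := by
    simp only [Matrix.det_apply', Matrix.of_apply, Finset.prod_univ_sum, Finset.mul_sum]
    rw [Finset.sum_comm]
    refine Finset.sum_congr rfl fun p _ => Finset.sum_congr rfl fun σ _ => ?_
    rw [Finset.prod_mul_distrib]
    ring
  have h2 : ∑ p ∈ Fintype.piFinset fun _ : Fin N => S,
        (∏ i, g i (p i)) * Matrix.det (Matrix.of fun i j => f i (p j)) =
      ∑ p ∈ (Fintype.piFinset fun _ : Fin N => S).filter Function.Injective,
        (∏ i, g i (p i)) * Matrix.det (Matrix.of fun i j => f i (p j)) := by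
    symm
    refine Finset.sum_filter_of_ne fun p _ hp => ?_
    by_contra hinj
    simp only [Function.Injective, not_forall] at hinj
    obtain ⟨i, j, hij, hne⟩ := hinj
    refine hp ?_
    rw [Matrix.det_zero_of_column_eq hne, mul_zero]
    intro k
    simp [hij]
  -- An injective tuple is, in exactly one way, an increasing tuple composed with a permutation; the
  -- permutation sorts it.
  have h3 : ∑ p ∈ (Fintype.piFinset fun _ : Fin N => S).filter Function.Injective,
        (∏ i, g i (p i)) * Matrix.det (Matrix.of fun i j => f i (p j)) =
      ∑ x ∈ ((Fintype.piFinset fun _ : Fin N => S).filter StrictMono) ×ˢ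
        (Finset.univ : Finset (Equiv.Perm (Fin N))),
        (∏ i, g i (x.1 (x.2 i))) * Matrix.det (Matrix.of fun i j => f i (x.1 (x.2 j))) := by
    symm
    refine Finset.sum_bij (fun x _ => x.1 ∘ x.2) ?_ ?_ ?_ ?_
    · rintro ⟨s, σ⟩ hx
      simp only [Finset.mem_product, Finset.mem_filter, Fintype.mem_piFinset,
        Finset.mem_univ, and_true] at hx ⊢
      exact ⟨fun i => hx.1 _, hx.2.injective.comp σ.injective⟩
    · rintro ⟨s, σ⟩ hx ⟨t, τ⟩ hy hxy
      simp only [Finset.mem_product, Finset.mem_filter, Finset.mem_univ, and_true] at hx hy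
      simp only at hxy
      have hst : s = t := by
        rw [← StrictMono.range_inj hx.2 hy.2, ← σ.surjective.range_comp s, hxy,
          τ.surjective.range_comp t]
      subst hst
      have : σ = τ := Equiv.ext fun i => hx.2.injective (congrFun hxy i)
      rw [this]
    · intro p hp
      simp only [Finset.mem_filter, Fintype.mem_piFinset] at hp
      refine ⟨(p ∘ Tuple.sort p, (Tuple.sort p)⁻¹), ?_, ?_⟩
      · simp only [Finset.mem_product, Finset.mem_filter, Fintype.mem_piFinset,
          Finset.mem_univ, and_true]
        exact ⟨fun i => hp.1 _, (Tuple.monotone_sort p).strictMono_of_injective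
          (hp.2.comp (Tuple.sort p).injective)⟩
      · funext i
        simp
    · rintro ⟨s, σ⟩ _
      rfl
  rw [h1, h2, h3, Finset.sum_product]
  refine Finset.sum_congr rfl fun s _ => ?_
  have h4 : ∀ σ : Equiv.Perm (Fin N), Matrix.det (Matrix.of fun i j => f i (s (σ j))) =
      Equiv.Perm.sign σ * Matrix.det (Matrix.of fun i j => f i (s j)) := fun σ =>
    Matrix.det_permute' σ (Matrix.of fun i j => f i (s j))
  rw [← Matrix.det_transpose (Matrix.of fun i j => g i (s j)),
    Matrix.det_apply' (Matrix.transpose _), Finset.mul_sum]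
  refine Finset.sum_congr rfl fun σ _ => ?_
  simp only [h4, Matrix.transpose_apply, Matrix.of_apply]
  ring

/-! ### The inverse of the symmetric Cauchy matrix -/

section Cauchy

variable {F : Type*} [Field F] {N : ℕ}

/-- The numbers `d_i = ∏_j (1 - a_i a_j) / ∏_{j ≠ i} (a_i - a_j)`. -/
def cauchyCoeff (a : Fin N → F) (i : Fin N) : F :=
  (∏ j, (1 - a i * a j)) * (∏ j ∈ Finset.univ.erase i, (a i - a j))⁻¹

/-- The polynomial `P(x) = ∏_{m ≠ i} (1 - a_m x)` has degree less than `N`, so it equals its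
Lagrange interpolant at the nodes `a_j`. The identity is this equality evaluated at `x = 1 / a_k`:
there `P` vanishes unless `k = i`, while `P(a_j) = ∏_m (1 - a_j a_m) / (1 - a_i a_j)` supplies the
numerator of `cauchyCoeff a j`. -/
theorem sum_cauchyCoeff (a : Fin N → F) (ha : Function.Injective a) (h0 : ∀ i, a i ≠ 0)
    (h1 : ∀ i j, 1 - a i * a j ≠ 0) (i k : Fin N) :
    ∑ j, cauchyCoeff a k * cauchyCoeff a j * ((1 - a k * a j)⁻¹ * (1 - a i * a j)⁻¹) =
      if i = k then 1 else 0 := by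
  classical
  let P : Polynomial F := ∏ m ∈ Finset.univ.erase i, (1 - Polynomial.C (a m) * Polynomial.X)
  have hP : ∀ x, P.eval x = ∏ m ∈ Finset.univ.erase i, (1 - a m * x) := by
    intro x
    simp [P, Polynomial.eval_prod]
  have hdeg : P.degree < (Finset.univ : Finset (Fin N)).card := by
    have hNpos : 0 < N := i.pos
    have h : P.natDegree ≤ N - 1 := by
      refine (Polynomial.natDegree_prod_le _ _).trans ?_
      refine (Finset.sum_le_card_nsmul _ _ 1 fun m _ => ?_).trans ?_
      · refine (Polynomial.natDegree_sub_le _ _).trans ?_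
        simpa using (Polynomial.natDegree_C_mul_le (a m) Polynomial.X).trans Polynomial.natDegree_X_le
      · simp
    refine lt_of_le_of_lt Polynomial.degree_le_natDegree ?_
    simp only [Finset.card_univ, Fintype.card_fin]
    exact_mod_cast (by omega : P.natDegree < N)
  have hint := Lagrange.eq_interpolate (s := Finset.univ) (v := a) (f := P) ha.injOn hdeg
  have hx : ∀ j ∈ (Finset.univ : Finset (Fin N)), (a k)⁻¹ ≠ a j := by
    intro j _ h
    apply h1 k j
    rw [← h, mul_inv_cancel₀ (h0 k), sub_self]
  have heval := Lagrange.eval_interpolate_not_at_node (s := Finset.univ) (v := a)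
    (fun j => P.eval (a j)) hx
  rw [← hint, hP, Lagrange.eval_nodal] at heval
  have hak := h0 k
  have hNk : a k * a k ^ (N - 1) = a k ^ N := by
    rw [← pow_succ', Nat.sub_add_cancel k.pos]
  have hnod : ∏ m, ((a k)⁻¹ - a m) = (∏ m, (1 - a k * a m)) * (a k ^ N)⁻¹ := by
    have : ∀ m, (a k)⁻¹ - a m = (1 - a k * a m) * (a k)⁻¹ := by
      intro m; field_simp
    simp only [this, Finset.prod_mul_distrib, Finset.prod_const, Finset.card_univ,
      Fintype.card_fin, inv_pow]
  have hterm : ∀ j, Lagrange.nodalWeight Finset.univ a j * ((a k)⁻¹ - a j)⁻¹ * P.eval (a j) =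
      a k * (cauchyCoeff a j * ((1 - a k * a j)⁻¹ * (1 - a i * a j)⁻¹)) := by
    intro j
    have e1 : ((a k)⁻¹ - a j)⁻¹ = a k * (1 - a k * a j)⁻¹ := by
      have : (a k)⁻¹ - a j = (1 - a k * a j) * (a k)⁻¹ := by field_simp
      rw [this, mul_inv, inv_inv, mul_comm]
    have e2 : P.eval (a j) = (∏ m, (1 - a j * a m)) * (1 - a i * a j)⁻¹ := by
      rw [hP, ← Finset.mul_prod_erase Finset.univ (fun m => 1 - a j * a m) (Finset.mem_univ i)]
      have := h1 i j
      rw [mul_comm (a j) (a i), mul_comm (1 - a i * a j), mul_assoc, mul_inv_cancel₀ this, mul_one]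
      exact Finset.prod_congr rfl fun m _ => by rw [mul_comm]
    rw [e1, e2, Lagrange.nodalWeight, Finset.prod_inv_distrib, cauchyCoeff]
    ring
  simp only [hterm, hnod] at heval
  rw [← Finset.mul_sum] at heval
  simp only [mul_assoc (cauchyCoeff a k)]
  rw [← Finset.mul_sum]
  set T := ∑ j, cauchyCoeff a j * ((1 - a k * a j)⁻¹ * (1 - a i * a j)⁻¹) with hT
  have hne : (∏ m, (1 - a k * a m)) ≠ 0 := Finset.prod_ne_zero_iff.2 fun m _ => h1 k m
  split_ifs with hik
  · subst hik
    have hL : ∏ m ∈ Finset.univ.erase i, (1 - a m * (a i)⁻¹) =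
        (∏ m ∈ Finset.univ.erase i, (a i - a m)) * (a i ^ (N - 1))⁻¹ := by
      have : ∀ m, 1 - a m * (a i)⁻¹ = (a i - a m) * (a i)⁻¹ := by
        intro m; field_simp
      simp only [this, Finset.prod_mul_distrib, Finset.prod_const, inv_pow]
      simp
    have hD : (∏ m ∈ Finset.univ.erase i, (a i - a m)) ≠ 0 := by
      refine Finset.prod_ne_zero_iff.2 fun m hm => sub_ne_zero.2 fun h => ?_
      exact (Finset.ne_of_mem_erase hm) (ha h).symm
    rw [hL, ← hNk] at heval
    have hp : a i ^ (N - 1) ≠ 0 := pow_ne_zero _ hak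
    have h2 : (∏ m ∈ Finset.univ.erase i, (a i - a m)) = (∏ m, (1 - a i * a m)) * T := by
      field_simp at heval
      exact heval
    rw [cauchyCoeff, mul_right_comm, ← h2, mul_inv_cancel₀ hD]
  · have hL : ∏ m ∈ Finset.univ.erase i, (1 - a m * (a k)⁻¹) = 0 :=
      Finset.prod_eq_zero (Finset.mem_erase.2 ⟨fun h => hik h.symm, Finset.mem_univ k⟩)
        (by rw [mul_inv_cancel₀ hak, sub_self])
    rw [hL] at heval
    have hp : (a k ^ N)⁻¹ ≠ 0 := inv_ne_zero (pow_ne_zero _ hak)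
    have : T = 0 := by
      have h3 := heval.symm
      simpa [hne, hak] using h3
    rw [this, mul_zero]

/-- The symmetric Cauchy matrix `1 / (1 - a_i a_j)`. -/
def cauchyGram (a : Fin N → F) : Matrix (Fin N) (Fin N) F :=
  Matrix.of fun i j => (1 - a i * a j)⁻¹

theorem cauchyGram_mul (a : Fin N → F) (ha : Function.Injective a) (h0 : ∀ i, a i ≠ 0)
    (h1 : ∀ i j, 1 - a i * a j ≠ 0) :
    cauchyGram a * (Matrix.diagonal (cauchyCoeff a) * cauchyGram a *
      Matrix.diagonal (cauchyCoeff a)) = 1 := by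
  ext i k
  rw [Matrix.mul_apply, Matrix.one_apply, ← sum_cauchyCoeff a ha h0 h1 i k]
  refine Finset.sum_congr rfl fun j _ => ?_
  rw [Matrix.mul_diagonal, Matrix.diagonal_mul]
  simp only [cauchyGram, Matrix.of_apply]
  rw [mul_comm (a j) (a k)]
  ring

end Cauchy

/-! ### Sums over increasing tuples of natural numbers -/

-- On a finite box of tuples this is Cauchy–Binet. The terms are nonnegative and the box sums
-- converge, hence are bounded; so the whole family is summable, and its sum is the limit along the
-- boxes.
open Classical in
theorem hasSum_strictMono_det_sq {N : ℕ} (f : Fin N → ℕ → ℝ) (u : ℕ → ℝ) (hu : ∀ x, 0 ≤ u x)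
    (hs : ∀ i j, Summable fun x => f i x * (u x * f j x)) :
    HasSum (fun p : Fin N → ℕ => if StrictMono p then
        (∏ j, u (p j)) * Matrix.det (Matrix.of fun i j => f i (p j)) ^ 2 else 0)
      (Matrix.det (Matrix.of fun i j => ∑' x, f i x * (u x * f j x))) := by
  set w : (Fin N → ℕ) → ℝ := fun p => if StrictMono p then
        (∏ j, u (p j)) * Matrix.det (Matrix.of fun i j => f i (p j)) ^ 2 else 0 with hw
  have hw0 : ∀ p, 0 ≤ w p := by
    intro p
    simp only [hw]
    split_ifs
    · exact mul_nonneg (Finset.prod_nonneg fun j _ => hu _) (sq_nonneg _)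
    · exact le_rfl
  let S : ℕ → Finset (Fin N → ℕ) := fun L => Fintype.piFinset fun _ => Finset.range L
  have hS : Tendsto S atTop atTop := by
    refine tendsto_atTop_finset_of_monotone ?_ ?_
    · intro L M hLM p hp
      simp only [S, Fintype.mem_piFinset, Finset.mem_range] at hp ⊢
      exact fun i => (hp i).trans_le hLM
    · intro p
      refine ⟨∑ i, p i + 1, ?_⟩
      simp only [S, Fintype.mem_piFinset, Finset.mem_range]
      exact fun i => Nat.lt_succ_of_le
        (Finset.single_le_sum (f := p) (fun j _ => Nat.zero_le _) (Finset.mem_univ i))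
  have hsum : ∀ L, ∑ p ∈ S L, w p =
      Matrix.det (Matrix.of fun i j => ∑ x ∈ Finset.range L, f i x * (u x * f j x)) := by
    intro L
    rw [det_sum_mul_eq_sum_strictMono (Finset.range L) f (fun j x => u x * f j x),
      Finset.sum_filter]
    refine Finset.sum_congr rfl fun p _ => ?_
    simp only [hw]
    split_ifs
    · have := Matrix.det_mul_row (fun j => u (p j)) (Matrix.of fun i j => f i (p j))
      simp only [Matrix.of_apply] at this
      rw [this]
      ring
    · rfl
  have hlim : Tendsto (fun L => ∑ p ∈ S L, w p) atTop
      (𝓝 (Matrix.det (Matrix.of fun i j => ∑' x, f i x * (u x * f j x)))) := by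
    simp only [hsum]
    have hc : Continuous fun M : Matrix (Fin N) (Fin N) ℝ => M.det := continuous_id.matrix_det
    refine (hc.tendsto _).comp ?_
    refine tendsto_pi_nhds.2 fun i => tendsto_pi_nhds.2 fun j => ?_
    exact (hs i j).hasSum.tendsto_sum_nat
  obtain ⟨B, hB⟩ := hlim.bddAbove_range
  have hsummable : Summable w := by
    refine summable_of_sum_le hw0 (c := B) fun T => ?_
    obtain ⟨L, hL⟩ := (hS.eventually (eventually_ge_atTop T)).exists
    exact (Finset.sum_le_sum_of_subset_of_nonneg hL fun p _ _ => hw0 p).trans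
      (hB ⟨L, rfl⟩)
  have h2 := hsummable.hasSum.comp hS
  rw [tendsto_nhds_unique hlim h2]
  exact hsummable.hasSum

theorem prod_ite_mem_range {N k : ℕ} (z : Fin k → ℕ) (p : Fin N → ℕ) (t : ℝ)
    [DecidablePred fun x => x ∈ Set.range z] :
    (∏ j, if p j ∈ Set.range z then t else 1) =
      t ^ (Finset.univ.filter fun j => p j ∈ Set.range z).card := by
  rw [Finset.prod_ite]
  simp

theorem card_filter_mem_range_le {N k : ℕ} (z : Fin k → ℕ) (p : Fin N → ℕ)
    (hp : Function.Injective p) [DecidablePred fun x => x ∈ Set.range z] :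
    (Finset.univ.filter fun j => p j ∈ Set.range z).card ≤ k := by
  have h : ((Finset.univ.filter fun j => p j ∈ Set.range z).image p).card ≤
      (Finset.univ.image z).card := by
    refine Finset.card_le_card fun x hx => ?_
    simp only [Finset.mem_image, Finset.mem_filter, Finset.mem_univ, true_and] at hx ⊢
    obtain ⟨j, ⟨i, hi⟩, rfl⟩ := hx
    exact ⟨i, hi⟩
  rw [Finset.card_image_of_injective _ hp] at h
  exact h.trans (Finset.card_image_le.trans (by simp))

/-- The number of entries of `p` in the range of `z` is the exponent of `t` in the generating
function below. The maximal value `k` singles out the tuples that contain all of `z`, since a subset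
of full cardinality is everything. -/
theorem card_filter_mem_range_eq_iff {N k : ℕ} (z : Fin k → ℕ) (hz : Function.Injective z)
    (p : Fin N → ℕ) (hp : Function.Injective p) [DecidablePred fun x => x ∈ Set.range z] :
    (Finset.univ.filter fun j => p j ∈ Set.range z).card = k ↔ Set.range z ⊆ Set.range p := by
  have hsub : (Finset.univ.filter fun j => p j ∈ Set.range z).image p ⊆ Finset.univ.image z := by
    intro x hx
    simp only [Finset.mem_image, Finset.mem_filter, Finset.mem_univ, true_and] at hx ⊢
    obtain ⟨j, ⟨i, hi⟩, rfl⟩ := hx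
    exact ⟨i, hi⟩
  have hcz : (Finset.univ.image z).card = k := by
    rw [Finset.card_image_of_injective _ hz]; simp
  have hcp := Finset.card_image_of_injective
    (Finset.univ.filter fun j => p j ∈ Set.range z) hp
  constructor
  · intro h
    have heq := Finset.eq_of_subset_of_card_le hsub (by rw [hcz, hcp, h])
    rintro _ ⟨i, rfl⟩
    have : z i ∈ Finset.univ.image z := Finset.mem_image_of_mem z (Finset.mem_univ i)
    rw [← heq, Finset.mem_image] at this
    obtain ⟨j, _, hj⟩ := this
    exact ⟨j, hj⟩
  · intro h
    refine hcp.symm.trans (Eq.trans ?_ hcz)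
    refine congrArg _ (Finset.Subset.antisymm hsub fun x hx => ?_)
    simp only [Finset.mem_image, Finset.mem_filter, Finset.mem_univ, true_and] at hx ⊢
    obtain ⟨i, rfl⟩ := hx
    obtain ⟨j, hj⟩ := h ⟨i, rfl⟩
    exact ⟨j, ⟨i, hj.symm⟩, hj⟩

/-! ### The ensemble of squared determinants and its correlations -/

/-- The determinant `det (a_i ^ {p_j})`. -/
def powDet {N : ℕ} (a : Fin N → ℝ) (p : Fin N → ℕ) : ℝ :=
  Matrix.det (Matrix.of fun i j => a i ^ p j)

open Classical in
theorem hasSum_powDet_sq {N : ℕ} (a : Fin N → ℝ) (ha : ∀ i j, |a i * a j| < 1) :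
    HasSum (fun p : Fin N → ℕ => if StrictMono p then powDet a p ^ 2 else 0)
      (Matrix.det (cauchyGram a)) := by
  have h := hasSum_strictMono_det_sq (fun i x => a i ^ x) (fun _ => 1) (fun _ => zero_le_one)
    (fun i j => by
      simpa [← mul_pow] using summable_geometric_of_abs_lt_one (ha i j))
  simp only [one_mul, Finset.prod_const_one, ← mul_pow, tsum_geometric_of_abs_lt_one (ha _ _)] at h
  exact h

/-- The weight is `1` plus `t - 1` at the marked points; injectivity of `z` ensures that each marked
point is counted once. -/
theorem hasSum_weighted_pow {k : ℕ} (z : Fin k → ℕ) (hz : Function.Injective z) (t b : ℝ)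
    (hb : |b| < 1) [DecidablePred fun x => x ∈ Set.range z] :
    HasSum (fun x => (if x ∈ Set.range z then t else 1) * b ^ x)
      ((1 - b)⁻¹ + (t - 1) * ∑ i, b ^ z i) := by
  have h1 := hasSum_geometric_of_abs_lt_one hb
  have h2 : HasSum (fun x => ∑ i, if x = z i then (t - 1) * b ^ z i else 0)
      (∑ i, (t - 1) * b ^ z i) :=
    hasSum_sum fun i _ => hasSum_ite_eq (z i) ((t - 1) * b ^ z i)
  rw [Finset.mul_sum]
  refine HasSum.congr_fun (h1.add h2) fun x => ?_
  by_cases hx : x ∈ Set.range z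
  · obtain ⟨i, rfl⟩ := hx
    simp only [Set.mem_range_self, if_true, hz.eq_iff, Finset.sum_ite_eq, Finset.mem_univ]
    ring
  · have hne : ∀ i, x ≠ z i := fun i h => hx ⟨i, h.symm⟩
    simp [hx, hne]

open Classical in
/-- The determinantal formula for the biorthogonal ensemble `det (a_i ^ {p_j})²`. -/
theorem hasSum_powDet_sq_of_range_subset {N k : ℕ} (a : Fin N → ℝ) (ha : ∀ i j, |a i * a j| < 1)
    (H : Matrix (Fin N) (Fin N) ℝ) (hH : cauchyGram a * H = 1)
    (z : Fin k → ℕ) (hz : Function.Injective z) :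
    HasSum (fun p : Fin N → ℕ =>
        if StrictMono p ∧ Set.range z ⊆ Set.range p then powDet a p ^ 2 else 0)
      (Matrix.det (cauchyGram a) *
        Matrix.det (Matrix.of fun i j : Fin k => ∑ l, ∑ m, a l ^ z i * H l m * a m ^ z j)) := by
  set w : (Fin N → ℕ) → ℝ := fun p => if StrictMono p then powDet a p ^ 2 else 0 with hw
  have hw0 : ∀ p, 0 ≤ w p := by
    intro p
    simp only [hw]
    split_ifs
    · exact sq_nonneg _
    · exact le_rfl
  let m : (Fin N → ℕ) → ℕ := fun p => (Finset.univ.filter fun j => p j ∈ Set.range z).card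
  let Φ : Matrix (Fin N) (Fin k) ℝ := Matrix.of fun i l => a i ^ z l
  set K : Matrix (Fin k) (Fin k) ℝ :=
    Matrix.of fun i j : Fin k => ∑ l, ∑ m, a l ^ z i * H l m * a m ^ z j with hKdef
  have hK : K = Φ.transpose * H * Φ := by
    ext i j
    simp only [hKdef, Φ, Matrix.mul_apply, Matrix.of_apply, Matrix.transpose_apply, Finset.sum_mul]
    exact Finset.sum_comm
  -- Every point of `z` is marked by `t`. The Gram matrix becomes `G + (t - 1) Φ Φᵀ = G (1 + H Φ (t
  -- - 1) Φᵀ)`, and `det (1 + A B) = det (1 + B A)` reduces the second factor to size `k`.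
  have hgen : ∀ t : ℝ, 0 ≤ t → HasSum (fun p => t ^ m p * w p)
      (Matrix.det (cauchyGram a) * Matrix.det (1 + (t - 1) • K)) := by
    intro t ht
    have hsum := fun i j => hasSum_weighted_pow z hz t (a i * a j) (ha i j)
    have hsum' : ∀ i j, HasSum
        (fun x => a i ^ x * ((if x ∈ Set.range z then t else 1) * a j ^ x))
        ((1 - a i * a j)⁻¹ + (t - 1) * ∑ l, (a i * a j) ^ z l) := by
      intro i j
      refine HasSum.congr_fun (hsum i j) fun x => ?_
      rw [mul_pow]; ring
    have h := hasSum_strictMono_det_sq (fun i x => a i ^ x)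
      (fun x => if x ∈ Set.range z then t else 1)
      (fun x => by split_ifs <;> [exact ht; exact zero_le_one]) (fun i j => (hsum' i j).summable)
    have hdet : Matrix.det (Matrix.of fun i j =>
        ∑' x, a i ^ x * ((if x ∈ Set.range z then t else 1) * a j ^ x)) =
        Matrix.det (cauchyGram a) * Matrix.det (1 + (t - 1) • K) := by
      have e1 : (Matrix.of fun i j =>
          ∑' x, a i ^ x * ((if x ∈ Set.range z then t else 1) * a j ^ x)) =
          cauchyGram a * (1 + H * Φ * ((t - 1) • Φ.transpose)) := by
        rw [Matrix.mul_add, Matrix.mul_one, ← Matrix.mul_assoc, ← Matrix.mul_assoc, hH,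
          Matrix.one_mul]
        ext i j
        simp only [Matrix.of_apply, (hsum' i j).tsum_eq, Matrix.add_apply, cauchyGram,
          Matrix.mul_apply, Matrix.smul_apply, Matrix.transpose_apply, Φ, Finset.mul_sum,
          smul_eq_mul, mul_pow]
        congr 1
        exact Finset.sum_congr rfl fun l _ => by ring
      rw [e1, Matrix.det_mul, Matrix.det_one_add_mul_comm, hK, Matrix.smul_mul, Matrix.mul_assoc]
    rw [hdet] at h
    refine HasSum.congr_fun h fun p => ?_
    simp only [hw, m]
    split_ifs
    · rw [prod_ite_mem_range]; rfl
    · rw [mul_zero]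
  have hws : Summable w := (hasSum_powDet_sq a ha).summable
  have hm : ∀ p, StrictMono p → m p ≤ k := fun p hp => card_filter_mem_range_le z p hp.injective
  -- The coefficient of `t ^ k` is extracted by setting `t = ε⁻¹`, multiplying by `ε ^ k` and
  -- letting `ε` tend to 0. The subtraction `k - m p` is not truncated for increasing `p`, and the
  -- other tuples have weight zero.
  have hscaled : ∀ ε : ℝ, 0 < ε → ∑' p, ε ^ (k - m p) * w p =
      Matrix.det (cauchyGram a) * Matrix.det (ε • (1 : Matrix (Fin k) (Fin k) ℝ) + (1 - ε) • K) := by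
    intro ε hε
    have h := ((hgen ε⁻¹ (inv_nonneg.2 hε.le)).mul_left (ε ^ k)).tsum_eq
    have e : ε • (1 : Matrix (Fin k) (Fin k) ℝ) + (1 - ε) • K = ε • (1 + (ε⁻¹ - 1) • K) := by
      rw [smul_add, smul_smul, mul_sub, mul_inv_cancel₀ hε.ne', mul_one]
    rw [e, Matrix.det_smul, Fintype.card_fin, mul_left_comm, ← h]
    refine tsum_congr fun p => ?_
    by_cases hp : StrictMono p
    · rw [← mul_assoc, pow_sub₀ _ hε.ne' (hm p hp), inv_pow]
    · simp [hw, hp]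
  have hlim1 : Tendsto (fun ε : ℝ => ∑' p, ε ^ (k - m p) * w p) (𝓝[>] 0)
      (𝓝 (∑' p, (0 : ℝ) ^ (k - m p) * w p)) := by
    refine tendsto_tsum_of_dominated_convergence (bound := w) hws ?_ ?_
    · intro p
      have hc : Continuous fun ε : ℝ => ε ^ (k - m p) * w p := by fun_prop
      exact (hc.tendsto 0).mono_left nhdsWithin_le_nhds
    · have hmem : Set.Ioo (0 : ℝ) 1 ∈ 𝓝[>] (0 : ℝ) := Ioo_mem_nhdsGT zero_lt_one
      filter_upwards [hmem] with ε hε p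
      rw [Real.norm_eq_abs, abs_of_nonneg (mul_nonneg (pow_nonneg hε.1.le _) (hw0 p))]
      exact mul_le_of_le_one_left (hw0 p) (pow_le_one₀ hε.1.le hε.2.le)
  have hlim2 : Tendsto (fun ε : ℝ => ∑' p, ε ^ (k - m p) * w p) (𝓝[>] 0)
      (𝓝 (Matrix.det (cauchyGram a) * Matrix.det K)) := by
    have hc : Continuous fun ε : ℝ => Matrix.det (cauchyGram a) *
        Matrix.det (ε • (1 : Matrix (Fin k) (Fin k) ℝ) + (1 - ε) • K) := by
      refine continuous_const.mul (Continuous.matrix_det ?_)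
      fun_prop
    have h0 := (hc.tendsto 0).mono_left (nhdsWithin_le_nhds (s := Set.Ioi 0))
    simp only [zero_smul, zero_add, sub_zero, one_smul] at h0
    refine h0.congr' ?_
    filter_upwards [self_mem_nhdsWithin] with ε hε
    exact (hscaled ε hε).symm
  -- At `ε = 0` the convention `0 ^ 0 = 1` keeps exactly the tuples with `m p = k`.
  have hfun : (fun p : Fin N → ℕ =>
      if StrictMono p ∧ Set.range z ⊆ Set.range p then powDet a p ^ 2 else 0) =
      fun p => (0 : ℝ) ^ (k - m p) * w p := by
    funext p
    by_cases hp : StrictMono p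
    · have hiff := card_filter_mem_range_eq_iff z hz p hp.injective
      have hmk := hm p hp
      by_cases hsub : Set.range z ⊆ Set.range p
      · have : m p = k := hiff.2 hsub
        simp [hp, hsub, hw, this]
      · have : m p ≠ k := fun h => hsub (hiff.1 h)
        have h2 : k - m p ≠ 0 := by omega
        simp [hsub, zero_pow h2]
    · simp [hp, hw]
  rw [hfun, tendsto_nhds_unique hlim2 hlim1]
  refine Summable.hasSum (Summable.of_nonneg_of_le
    (fun p => mul_nonneg (pow_nonneg le_rfl _) (hw0 p)) (fun p => ?_) hws)
  exact mul_le_of_le_one_left (hw0 p) (pow_le_one₀ le_rfl zero_le_one)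

/-! ### Hook lengths -/

theorem rowLen_eq_zero {lam : YoungDiagram} {i : ℕ} (h : lam.colLen 0 ≤ i) : lam.rowLen i = 0 := by
  by_contra hne
  have : (i, 0) ∈ lam := YoungDiagram.mem_iff_lt_rowLen.2 (Nat.pos_of_ne_zero hne)
  rw [YoungDiagram.mem_iff_lt_colLen] at this
  omega

theorem prod_cells {M : Type*} [CommMonoid M] {lam : YoungDiagram} {N : ℕ}
    (hN : lam.colLen 0 ≤ N) (f : ℕ × ℕ → M) :
    ∏ c ∈ lam.cells, f c = ∏ i ∈ Finset.range N, ∏ j ∈ Finset.range (lam.rowLen i), f (i, j) := by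
  refine Finset.prod_finset_product _ _ (fun i => Finset.range (lam.rowLen i)) ?_
  rintro ⟨i, j⟩
  simp only [YoungDiagram.mem_cells, YoungDiagram.mem_iff_lt_rowLen, Finset.mem_range]
  constructor
  · intro h
    refine ⟨?_, h⟩
    by_contra hi
    rw [rowLen_eq_zero (hN.trans (not_lt.1 hi))] at h
    omega
  · exact fun h => h.2

theorem card_eq_sum_rowLen {lam : YoungDiagram} {N : ℕ} (hN : lam.colLen 0 ≤ N) :
    lam.card = ∑ i ∈ Finset.range N, lam.rowLen i := by
  -- `Multiplicative ℕ` turns the product formula into a formula for sums.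
  have h := prod_cells (M := Multiplicative ℕ) hN (fun _ => Multiplicative.ofAdd 1)
  have h2 : lam.card = ∑ c ∈ lam.cells, 1 := Finset.card_eq_sum_ones _
  rw [h2]
  refine (show ∑ c ∈ lam.cells, 1 = _ from h).trans ?_
  refine Finset.sum_congr rfl fun i _ => ?_
  show ∑ j ∈ Finset.range (lam.rowLen i), 1 = _
  simp

theorem bStat_eq_sum {lam : YoungDiagram} {N : ℕ} (hN : lam.colLen 0 ≤ N) :
    bStat lam = ∑ i ∈ Finset.range N, i * lam.rowLen i := by
  refine Finset.sum_subset (Finset.range_mono hN) fun i _ hi => ?_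
  rw [rowLen_eq_zero (by simpa using hi), mul_zero]

/-- The hook lengths in a row, together with the differences of the shifted row lengths, exhaust an
initial segment of the positive integers. -/
theorem prod_hook_row {M : Type*} [CommMonoid M] {lam : YoungDiagram} {N r : ℕ}
    (hN : lam.colLen 0 ≤ N) (hr : r < N) (f : ℕ → M) :
    (∏ j ∈ Finset.range (lam.rowLen r), f (hook lam (r, j))) *
        ∏ i ∈ Finset.Ioo r N, f (lam.rowLen r + i - lam.rowLen i - r) =
      ∏ k ∈ Finset.range (lam.rowLen r + (N - 1 - r)), f (k + 1) := by
  classical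
  have hcol : ∀ j < lam.rowLen r, r < lam.colLen j ∧ lam.colLen j ≤ N := fun j hj =>
    ⟨YoungDiagram.mem_iff_lt_colLen.1 (YoungDiagram.mem_iff_lt_rowLen.2 hj),
      (lam.colLen_anti 0 j (Nat.zero_le j)).trans hN⟩
  have hanti := lam.rowLen_anti
  have hcanti := lam.colLen_anti
  have hinj1 : Set.InjOn (fun j => hook lam (r, j)) (Finset.range (lam.rowLen r)) := by
    have key : ∀ i j, i < j → j < lam.rowLen r → hook lam (r, j) < hook lam (r, i) := by
      intro i j hij hj
      have h1 := hcol j hj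
      have h3 := hcanti i j hij.le
      simp only [hook]
      omega
    intro i hi j hj hij
    simp only [Finset.coe_range, Set.mem_Iio] at hi hj
    simp only at hij
    rcases lt_trichotomy i j with h | h | h
    · have := key i j h hj; omega
    · exact h
    · have := key j i h hi; omega
  have hinj2 : Set.InjOn (fun i => lam.rowLen r + i - lam.rowLen i - r) (Finset.Ioo r N) := by
    have key : ∀ i j, r < i → i < j →
        lam.rowLen r + i - lam.rowLen i - r < lam.rowLen r + j - lam.rowLen j - r := by
      intro i j hi hij
      have h3 := hanti i j hij.le
      have h4 := hanti r i hi.le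
      omega
    intro i hi j hj hij
    simp only [Finset.coe_Ioo, Set.mem_Ioo] at hi hj
    simp only at hij
    rcases lt_trichotomy i j with h | h | h
    · have := key i j hi.1 h; omega
    · exact h
    · have := key j i hj.1 h; omega
  set S := (Finset.range (lam.rowLen r)).image fun j => hook lam (r, j) with hS
  set T := (Finset.Ioo r N).image fun i => lam.rowLen r + i - lam.rowLen i - r with hT
  -- The hook length at `(r, j)` minus the difference for row `i` is `(λᵀ_j - i) + (λ_i - j) - 1`.
  -- This is positive if `(i, j)` is a cell and negative if it is not, so it never vanishes.
  have hdisj : Disjoint S T := by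
    rw [Finset.disjoint_left]
    intro x hxS hxT
    simp only [hS, hT, Finset.mem_image, Finset.mem_range, Finset.mem_Ioo] at hxS hxT
    obtain ⟨j, hj, rfl⟩ := hxS
    obtain ⟨i, hi, hij⟩ := hxT
    have h1 := hcol j hj
    have h2 := hanti r i hi.1.le
    simp only [hook] at hij
    by_cases hmem : (i, j) ∈ lam
    · have a1 := YoungDiagram.mem_iff_lt_rowLen.1 hmem
      have a2 := YoungDiagram.mem_iff_lt_colLen.1 hmem
      omega
    · have a1 : ¬ j < lam.rowLen i := fun h => hmem (YoungDiagram.mem_iff_lt_rowLen.2 h)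
      have a2 : ¬ i < lam.colLen j := fun h => hmem (YoungDiagram.mem_iff_lt_colLen.2 h)
      omega
  have hcardS : S.card = lam.rowLen r := by
    rw [hS, Finset.card_image_of_injOn hinj1, Finset.card_range]
  have hcardT : T.card = N - 1 - r := by
    rw [hT, Finset.card_image_of_injOn hinj2, Nat.card_Ioo]
    omega
  -- Both sets lie in the segment from `1` to `λ_r + N - 1 - r`, and their cardinalities `λ_r` and
  -- `N - 1 - r` add up to its length.
  have hunion : S ∪ T = (Finset.range (lam.rowLen r + (N - 1 - r))).image Nat.succ := by
    refine Finset.eq_of_subset_of_card_le ?_ ?_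
    · intro x hx
      simp only [hS, hT, Finset.mem_union, Finset.mem_image, Finset.mem_range,
        Finset.mem_Ioo] at hx ⊢
      refine ⟨x - 1, ?_⟩
      rcases hx with ⟨j, hj, rfl⟩ | ⟨i, hi, rfl⟩
      · have h1 := hcol j hj
        simp only [hook]
        omega
      · have h2 := hanti r i hi.1.le
        omega
    · rw [Finset.card_union_of_disjoint hdisj, hcardS, hcardT,
        Finset.card_image_of_injective _ Nat.succ_injective, Finset.card_range]
  have h1 : ∏ x ∈ S, f x = ∏ j ∈ Finset.range (lam.rowLen r), f (hook lam (r, j)) :=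
    Finset.prod_image hinj1
  have h2 : ∏ x ∈ T, f x = ∏ i ∈ Finset.Ioo r N, f (lam.rowLen r + i - lam.rowLen i - r) :=
    Finset.prod_image hinj2
  rw [← h1, ← h2, ← Finset.prod_union hdisj, hunion,
    Finset.prod_image Nat.succ_injective.injOn]

/-! ### Partitions with at most `N` rows as increasing tuples -/

/-- The increasing tuple `λ_{N - j} + j` of shifted row lengths. -/
def shiftedRows (N : ℕ) (lam : YoungDiagram) (j : Fin N) : ℕ := lam.rowLen j.rev + j

theorem strictMono_shiftedRows (N : ℕ) (lam : YoungDiagram) : StrictMono (shiftedRows N lam) := by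
  intro i j hij
  have h := lam.rowLen_anti j.rev i.rev (by simp only [Fin.val_rev]; omega)
  simp only [shiftedRows]
  omega

theorem shiftedRows_injOn (N : ℕ) :
    Set.InjOn (shiftedRows N) {lam : YoungDiagram | lam.colLen 0 ≤ N} := by
  intro lam hlam mu hmu h
  have hrow : ∀ i, lam.rowLen i = mu.rowLen i := by
    intro i
    rcases lt_or_ge i N with hi | hi
    · have := congrFun h (Fin.rev ⟨i, hi⟩)
      simp only [shiftedRows, Fin.rev_rev] at this
      omega
    · rw [rowLen_eq_zero (le_trans hlam hi), rowLen_eq_zero (le_trans hmu hi)]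
  refine YoungDiagram.ext ?_
  ext ⟨i, j⟩
  rw [YoungDiagram.mem_cells, YoungDiagram.mem_cells, YoungDiagram.mem_iff_lt_rowLen,
    YoungDiagram.mem_iff_lt_rowLen, hrow]

theorem exists_shiftedRows_eq {N : ℕ} (p : Fin N → ℕ) (hp : StrictMono p) :
    ∃ lam : YoungDiagram, lam.colLen 0 ≤ N ∧ shiftedRows N lam = p := by
  have hle : ∀ i j : Fin N, i ≤ j → p i - i ≤ p j - j ∧ (i : ℕ) ≤ p i := by
    -- A strictly increasing map injects `[i, j)` into `[p i, p j)`; hence `p i - i` is weakly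
    -- increasing, as the row lengths of a diagram require.
    have hstep : ∀ i j : Fin N, i ≤ j → p i + ((j : ℕ) - i) ≤ p j := by
      intro i j hij
      have hcard := Finset.card_le_card_of_injOn p (s := Finset.Ico i j)
        (t := Finset.Ico (p i) (p j)) (fun x hx => by
          simp only [Finset.coe_Ico, Set.mem_Ico] at hx ⊢
          exact ⟨hp.monotone hx.1, hp hx.2⟩) hp.injective.injOn
      have := hp.monotone hij
      simp only [Fin.card_Ico, Nat.card_Ico] at hcard
      omega
    intro i j hij
    have h1 := hstep i j hij
    have h0 := hstep ⟨0, i.pos⟩ i (Fin.mk_le_of_le_val (Nat.zero_le _))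
    have : (i : ℕ) ≤ j := hij
    simp only at h0
    omega
  let row : ℕ → ℕ := fun i => if h : i < N then p (Fin.rev ⟨i, h⟩) - (Fin.rev ⟨i, h⟩ : Fin N) else 0
  have hrow : ∀ i j, i ≤ j → row j ≤ row i := by
    intro i j hij
    simp only [row]
    split_ifs with h1 h2
    · exact (hle _ _ (Fin.rev_le_rev.2 (Fin.mk_le_mk.2 hij))).1
    · omega
    · omega
    · omega
  let lam : YoungDiagram :=
    { cells := (Finset.range N).sigma (fun i => Finset.range (row i)) |>.map
        (Equiv.sigmaEquivProd ℕ ℕ).toEmbedding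
      isLowerSet := by
        rintro ⟨i, j⟩ ⟨i', j'⟩ hle' hmem
        obtain ⟨h1, h2⟩ := Prod.mk_le_mk.1 hle'
        simp only [Finset.coe_map, Set.mem_image, Finset.mem_coe, Finset.mem_sigma,
          Finset.mem_range, Equiv.coe_toEmbedding, Sigma.exists, Equiv.sigmaEquivProd_apply,
          Prod.mk.injEq] at hmem ⊢
        obtain ⟨a, b, ⟨ha, hb⟩, rfl, rfl⟩ := hmem
        have := hrow i' a h1
        exact ⟨i', j', ⟨by omega, by omega⟩, rfl, rfl⟩ }
  have hmem : ∀ i j, (i, j) ∈ lam ↔ i < N ∧ j < row i := by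
    intro i j
    rw [← YoungDiagram.mem_cells]
    simp only [lam, Finset.mem_map, Finset.mem_sigma, Finset.mem_range, Equiv.coe_toEmbedding,
      Sigma.exists, Equiv.sigmaEquivProd_apply, Prod.mk.injEq]
    constructor
    · rintro ⟨a, b, h, rfl, rfl⟩
      exact h
    · exact fun h => ⟨i, j, h, rfl, rfl⟩
  have hlen : ∀ i, i < N → lam.rowLen i = row i := by
    intro i hi
    have h : ∀ j, j < lam.rowLen i ↔ j < row i := fun j => by
      rw [← YoungDiagram.mem_iff_lt_rowLen, hmem]; simp [hi]
    have h1 := h (lam.rowLen i)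
    have h2 := h (row i)
    omega
  refine ⟨lam, ?_, ?_⟩
  · by_contra hcon
    have : (N, 0) ∈ lam := YoungDiagram.mem_iff_lt_colLen.2 (not_le.1 hcon)
    exact absurd ((hmem N 0).1 this).1 (lt_irrefl N)
  · funext j
    have h1 := (hle j j le_rfl).2
    simp only [shiftedRows]
    rw [hlen _ j.rev.isLt]
    simp only [row, Fin.is_lt, dif_pos, Fin.eta, Fin.rev_rev]
    omega

/-- A sum over partitions with at most `N` rows is a sum over increasing tuples. -/
theorem hasSum_youngDiagram {N : ℕ} {F : YoungDiagram → ℝ} {G : (Fin N → ℕ) → ℝ} {x : ℝ}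
    (hF : ∀ lam : YoungDiagram, ¬ lam.colLen 0 ≤ N → F lam = 0)
    (hG : ∀ p, ¬ StrictMono p → G p = 0)
    (hFG : ∀ lam : YoungDiagram, lam.colLen 0 ≤ N → F lam = G (shiftedRows N lam))
    (h : HasSum G x) : HasSum F x := by
  have h1 : HasSum (fun lam : {lam : YoungDiagram | lam.colLen 0 ≤ N} =>
      G (shiftedRows N lam)) x := by
    have hinj : Function.Injective fun lam : {lam : YoungDiagram | lam.colLen 0 ≤ N} =>
        shiftedRows N lam := fun a b hab => Subtype.ext (shiftedRows_injOn N a.2 b.2 hab)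
    refine (hinj.hasSum_iff fun p hp => hG p fun hmono => hp ?_).2 h
    obtain ⟨lam, hl, rfl⟩ := exists_shiftedRows_eq p hmono
    exact ⟨⟨lam, hl⟩, rfl⟩
  refine (hasSum_subtype_iff_of_support_subset
    (s := {lam : YoungDiagram | lam.colLen 0 ≤ N}) fun lam hl => ?_).1 (HasSum.congr_fun h1 ?_)
  · by_contra hcon
    exact hl (hF lam hcon)
  · rintro ⟨lam, hl⟩
    exact hFG lam hl

/-! ### The weight as a squared determinant -/

/-- Since `(q ^ i) ^ p_j = (q ^ p_j) ^ i`, geometric parameters turn the matrix into a Vandermonde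
matrix in the nodes `q ^ p_j`, up to column factors `c ^ p_j`. -/
theorem powDet_geometric {N : ℕ} (c q : ℝ) (p : Fin N → ℕ) :
    powDet (fun i : Fin N => c * q ^ (i : ℕ)) p =
      (∏ j, c ^ p j) * ∏ j, ∏ i ∈ Finset.Iio j, (q ^ p j - q ^ p i) := by
  have h := Matrix.det_mul_row (fun j => c ^ p j)
    (Matrix.of fun i j : Fin N => (Matrix.vandermonde fun j => q ^ p j).transpose i j)
  have h2 : (Matrix.of fun i j : Fin N => (Matrix.vandermonde fun j => q ^ p j).transpose i j) =
    (Matrix.vandermonde fun j => q ^ p j).transpose := rfl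
  rw [h2, Matrix.det_transpose, Matrix.det_vandermonde] at h
  have h3 : ∏ j, ∏ i ∈ Finset.Iio j, (q ^ p j - q ^ p i) =
      ∏ i, ∏ j ∈ Finset.Ioi i, (q ^ p j - q ^ p i) :=
    Finset.prod_comm' (by simp)
  rw [h3, ← h, powDet]
  congr 1
  ext i j
  simp only [Matrix.of_apply, Matrix.transpose_apply, Matrix.vandermonde_apply]
  rw [mul_pow, ← pow_mul, ← pow_mul, mul_comm (p j)]

/-- The unnormalized weight of a partition. -/
def rawWeight (ξ q : ℝ) (lam : YoungDiagram) : ℝ :=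
  (ξ ^ 2 * q) ^ lam.card * q ^ (2 * bStat lam) * ∏ c ∈ lam.cells, 1 / (1 - q ^ hook lam c) ^ 2

/-- The ratio of the weight in the ensemble with `N` rows to the unnormalized weight. -/
def rowRatio (q : ℝ) (N : ℕ) (lam : YoungDiagram) : ℝ :=
  ∏ j : Fin N, (qPoch q q (shiftedRows N lam j) / qPoch q q j) ^ 2

theorem qPoch_self (q : ℝ) (n : ℕ) : qPoch q q n = ∏ k ∈ Finset.range n, (1 - q ^ (k + 1)) :=
  Finset.prod_congr rfl fun k _ => by rw [pow_succ']

theorem qPoch_self_pos {q : ℝ} (hq : 0 < q) (hq1 : q < 1) (n : ℕ) : 0 < qPoch q q n := by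
  rw [qPoch_self]
  exact Finset.prod_pos fun k _ => sub_pos.2 (pow_lt_one₀ hq.le hq1 (Nat.succ_ne_zero k))

theorem hook_pos {lam : YoungDiagram} {c : ℕ × ℕ} (hc : c ∈ lam.cells) : 0 < hook lam c := by
  have h1 := YoungDiagram.mem_iff_lt_rowLen.1 hc
  have h2 := YoungDiagram.mem_iff_lt_colLen.1 hc
  simp only [hook]
  omega

/-- This is `prod_hook_row` multiplied over all rows, with `f k = 1 - q ^ k`. Row `N - 1 - j`
exhausts the integers from `1` to `shiftedRows N lam j`, whence the factor `qPoch q q (shiftedRows N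
lam j)`. -/
theorem prod_one_sub_hook {q : ℝ} {lam : YoungDiagram} {N : ℕ} (hN : lam.colLen 0 ≤ N) :
    (∏ c ∈ lam.cells, (1 - q ^ hook lam c)) *
        ∏ j : Fin N, ∏ i ∈ Finset.Iio j, (1 - q ^ (shiftedRows N lam j - shiftedRows N lam i)) =
      ∏ j : Fin N, qPoch q q (shiftedRows N lam j) := by
  rw [prod_cells hN, Finset.prod_range, ← Equiv.prod_comp Fin.revPerm, ← Finset.prod_mul_distrib]
  refine Finset.prod_congr rfl fun j _ => ?_
  have h := prod_hook_row hN j.rev.isLt (fun k => 1 - q ^ k)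
  have h2 : ∏ i ∈ Finset.Iio j, (1 - q ^ (shiftedRows N lam j - shiftedRows N lam i)) =
      ∏ i ∈ Finset.Ioo (j.rev : ℕ) N,
        (1 - q ^ (lam.rowLen j.rev + i - lam.rowLen i - (j.rev : ℕ))) := by
    refine Finset.prod_bij (fun i _ => (i.rev : ℕ)) ?_ ?_ ?_ ?_
    · intro i hi
      have : i < j := Finset.mem_Iio.1 hi
      simp only [Finset.mem_Ioo, Fin.val_rev]
      omega
    · intro i _ i' _ hii
      exact Fin.rev_injective (Fin.ext hii)
    · intro i hi
      rw [Finset.mem_Ioo] at hi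
      refine ⟨Fin.rev ⟨i, hi.2⟩, ?_, by simp⟩
      simp only [Finset.mem_Iio, Fin.lt_def, Fin.val_rev] at hi ⊢
      omega
    · intro i hi
      have hij : i < j := Finset.mem_Iio.1 hi
      have := lam.rowLen_anti j.rev i.rev (by simp only [Fin.val_rev]; omega)
      congr 2
      simp only [shiftedRows]
      have e1 := Fin.val_rev i
      have e2 := Fin.val_rev j
      omega
  rw [Fin.revPerm_apply, h2, h, qPoch_self, shiftedRows]
  congr 2
  simp only [Fin.val_rev]
  omega

/-- The ratio of the two determinants is the Schur polynomial at `c, c q, …, c q^{N-1}`, and this is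
its hook formula. Cleared of denominators, it needs no condition on `c` and `q`. -/
theorem powDet_shiftedRows {c q : ℝ} {N : ℕ}
    {lam : YoungDiagram} (hN : lam.colLen 0 ≤ N) :
    powDet (fun i : Fin N => c * q ^ (i : ℕ)) (shiftedRows N lam) *
      (∏ x ∈ lam.cells, (1 - q ^ hook lam x)) * ∏ j : Fin N, qPoch q q j =
    powDet (fun i : Fin N => c * q ^ (i : ℕ)) (fun j => (j : ℕ)) * c ^ lam.card * q ^ bStat lam *
      ∏ j : Fin N, qPoch q q (shiftedRows N lam j) := by
  -- From each difference the smaller power `q ^ p i` is pulled out; it occurs once for every `j >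
  -- i`, that is `i.rev` times. The sign does not depend on `p`.
  have hdiff : ∀ p : Fin N → ℕ, StrictMono p →
      ∏ j, ∏ i ∈ Finset.Iio j, (q ^ p j - q ^ p i) =
        (∏ j : Fin N, ∏ i ∈ Finset.Iio j, (-1 : ℝ)) * (∏ i : Fin N, q ^ (p i * (i.rev : ℕ))) *
          ∏ j, ∏ i ∈ Finset.Iio j, (1 - q ^ (p j - p i)) := by
    intro p hp
    have e : ∏ i : Fin N, q ^ (p i * (i.rev : ℕ)) = ∏ j, ∏ i ∈ Finset.Iio j, q ^ p i := by
      rw [Finset.prod_comm' (t' := Finset.univ) (s' := fun i => Finset.Ioi i) (by simp)]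
      refine Finset.prod_congr rfl fun i _ => ?_
      rw [Finset.prod_const, Fin.card_Ioi, pow_mul, Fin.val_rev]
      congr 1
      omega
    rw [e]
    simp only [← Finset.prod_mul_distrib]
    refine Finset.prod_congr rfl fun j _ => Finset.prod_congr rfl fun i hi => ?_
    have hij : p i ≤ p j := hp.monotone (Finset.mem_Iio.1 hi).le
    have : q ^ p j = q ^ p i * q ^ (p j - p i) := by rw [← pow_add, Nat.add_sub_cancel' hij]
    rw [this]; ring
  -- The reference determinant belongs to the empty partition, so the same hook identity, with an
  -- empty hook product, evaluates it.
  have hbot : shiftedRows N ⊥ = fun j : Fin N => (j : ℕ) := by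
    funext j
    have : (⊥ : YoungDiagram).rowLen j.rev = 0 := by
      by_contra hne
      exact YoungDiagram.notMem_bot _ (YoungDiagram.mem_iff_lt_rowLen.2 (Nat.pos_of_ne_zero hne))
    rw [shiftedRows, this, zero_add]
  have hbotN : (⊥ : YoungDiagram).colLen 0 ≤ N := by
    by_contra hcon
    exact YoungDiagram.notMem_bot _ (YoungDiagram.mem_iff_lt_colLen.2 (not_le.1 hcon))
  have hE := prod_one_sub_hook (q := q) hbotN
  have hL := prod_one_sub_hook (q := q) hN
  rw [hbot] at hE
  simp only [YoungDiagram.cells_bot, Finset.prod_empty, one_mul] at hE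
  rw [powDet_geometric, powDet_geometric, hdiff _ (strictMono_shiftedRows N lam),
    hdiff _ (fun i j h => h), ← hL, ← hE]
  have hc : ∏ j, c ^ shiftedRows N lam j = (∏ j : Fin N, c ^ (j : ℕ)) * c ^ lam.card := by
    rw [card_eq_sum_rowLen hN, Finset.sum_range, ← Equiv.sum_comp Fin.revPerm,
      ← Finset.prod_pow_eq_pow_sum, ← Finset.prod_mul_distrib]
    refine Finset.prod_congr rfl fun j _ => ?_
    rw [shiftedRows, pow_add, mul_comm, Fin.revPerm_apply]
  have hb : ∏ i, q ^ (shiftedRows N lam i * (i.rev : ℕ)) =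
      (∏ i : Fin N, q ^ ((i : ℕ) * (i.rev : ℕ))) * q ^ bStat lam := by
    rw [bStat_eq_sum hN, Finset.sum_range, ← Equiv.sum_comp Fin.revPerm,
      ← Finset.prod_pow_eq_pow_sum, ← Finset.prod_mul_distrib]
    refine Finset.prod_congr rfl fun j _ => ?_
    rw [← pow_add, shiftedRows, Fin.revPerm_apply]
    congr 1
    ring
  rw [hc, hb]
  ring

/-- Squaring turns `c ^ |λ|` into `(ξ² q) ^ |λ|` and the hook formula into the unnormalized weight.
Apart from a constant, all dependence on `N` is in `rowRatio`. -/
theorem powDet_sq_shiftedRows {ξ c q : ℝ} (hc : c ^ 2 = ξ ^ 2 * q) (hq : 0 < q) (hq1 : q < 1)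
    {N : ℕ} {lam : YoungDiagram} (hN : lam.colLen 0 ≤ N) :
    powDet (fun i : Fin N => c * q ^ (i : ℕ)) (shiftedRows N lam) ^ 2 =
      powDet (fun i : Fin N => c * q ^ (i : ℕ)) (fun j => (j : ℕ)) ^ 2 *
        (rawWeight ξ q lam * rowRatio q N lam) := by
  have h := powDet_shiftedRows (c := c) (q := q) hN
  have h1 : (∏ x ∈ lam.cells, (1 - q ^ hook lam x)) ≠ 0 := Finset.prod_ne_zero_iff.2 fun x hx =>
    (sub_pos.2 (pow_lt_one₀ hq.le hq1 (hook_pos hx).ne')).ne'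
  have h2 : (∏ j : Fin N, qPoch q q j) ≠ 0 := Finset.prod_ne_zero_iff.2 fun j _ =>
    (qPoch_self_pos hq hq1 j).ne'
  have h3 : rawWeight ξ q lam =
      (c ^ lam.card * q ^ bStat lam / ∏ x ∈ lam.cells, (1 - q ^ hook lam x)) ^ 2 := by
    rw [rawWeight, ← hc, Finset.prod_div_distrib, Finset.prod_const_one, Finset.prod_pow]
    rw [div_pow, mul_pow, ← pow_mul, ← pow_mul, ← pow_mul]
    ring
  have h4 : rowRatio q N lam =
      ((∏ j : Fin N, qPoch q q (shiftedRows N lam j)) / ∏ j : Fin N, qPoch q q j) ^ 2 := by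
    rw [rowRatio, Finset.prod_pow, Finset.prod_div_distrib]
  rw [h3, h4, ← mul_pow, ← mul_pow]
  congr 1
  field_simp
  linear_combination h

/-! ### Euler's expansion of the infinite `q`-shifted factorial -/

theorem summable_mul_geometric {q : ℝ} (hq : 0 < q) (hq1 : q < 1) (x : ℝ) :
    Summable fun k : ℕ => -(x * q ^ k) :=
  ((summable_geometric_of_lt_one hq.le hq1).mul_left x).neg

theorem multipliable_qPochInf {q : ℝ} (hq : 0 < q) (hq1 : q < 1) (x : ℝ) :
    Multipliable fun k : ℕ => 1 - x * q ^ k := by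
  simp only [sub_eq_add_neg]
  exact multipliable_one_add_of_summable (summable_mul_geometric hq hq1 x).norm

theorem tendsto_qPoch {q : ℝ} (hq : 0 < q) (hq1 : q < 1) (x : ℝ) :
    Tendsto (qPoch x q) atTop (𝓝 (qPochInf x q)) :=
  (multipliable_qPochInf hq hq1 x).hasProd.tendsto_prod_nat

theorem qPoch_nonneg {x q : ℝ} (hq : 0 < q) (hq1 : q < 1) (hx : x ≤ 1) (n : ℕ) :
    0 ≤ qPoch x q n := by
  refine Finset.prod_nonneg fun k _ => sub_nonneg.2 ?_
  exact (mul_le_of_le_one_left (pow_nonneg hq.le k) hx).trans (pow_le_one₀ hq.le hq1.le)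

theorem qPoch_antitone {x q : ℝ} (hq : 0 < q) (hq1 : q < 1) (hx0 : 0 ≤ x) (hx : x ≤ 1) :
    Antitone (qPoch x q) := by
  refine antitone_nat_of_succ_le fun n => ?_
  rw [qPoch, Finset.prod_range_succ]
  refine mul_le_of_le_one_right (qPoch_nonneg hq hq1 hx n) ?_
  have := mul_nonneg hx0 (pow_nonneg hq.le n)
  linarith

theorem qPochInf_le_qPoch {x q : ℝ} (hq : 0 < q) (hq1 : q < 1) (hx0 : 0 ≤ x) (hx : x ≤ 1)
    (n : ℕ) : qPochInf x q ≤ qPoch x q n :=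
  (qPoch_antitone hq hq1 hx0 hx).le_of_tendsto (tendsto_qPoch hq hq1 x) n

theorem qPochInf_nonneg {x q : ℝ} (hq : 0 < q) (hq1 : q < 1) (hx : x ≤ 1) : 0 ≤ qPochInf x q :=
  ge_of_tendsto' (tendsto_qPoch hq hq1 x) (qPoch_nonneg hq hq1 hx)

theorem qPochInf_le_one {x q : ℝ} (hq : 0 < q) (hq1 : q < 1) (hx0 : 0 ≤ x) (hx : x ≤ 1) :
    qPochInf x q ≤ 1 := by
  simpa [qPoch] using qPochInf_le_qPoch hq hq1 hx0 hx 0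

theorem qPochInf_pos {x q : ℝ} (hq : 0 < q) (hq1 : q < 1) (hx : x < 1) : 0 < qPochInf x q := by
  refine lt_of_le_of_ne (qPochInf_nonneg hq hq1 hx.le) (Ne.symm ?_)
  have h := tprod_one_add_ne_zero_of_summable (f := fun k : ℕ => -(x * q ^ k)) (fun k => ?_)
    (summable_mul_geometric hq hq1 x).norm
  · simpa only [← sub_eq_add_neg, qPochInf] using h
  · have h1 : x * q ^ k ≤ max x 0 := by
      rcases le_total x 0 with h | h
      · exact (mul_nonpos_of_nonpos_of_nonneg h (pow_nonneg hq.le k)).trans (le_max_right _ _)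
      · exact (mul_le_of_le_one_right h (pow_le_one₀ hq.le hq1.le)).trans (le_max_left _ _)
    have h2 : max x 0 < 1 := max_lt hx one_pos
    linarith

theorem qPochInf_eq_mul {q : ℝ} (hq : 0 < q) (hq1 : q < 1) (x : ℝ) :
    qPochInf x q = (1 - x) * qPochInf (x * q) q := by
  have hterm : ∀ k : ℕ, 1 - x * q ^ (k + 1) = 1 - x * q * q ^ k := fun k => by ring
  have h := Multipliable.prod_mul_tprod_nat_mul' (f := fun k : ℕ => 1 - x * q ^ k) (k := 1) (by
    simp only [hterm]
    exact multipliable_qPochInf hq hq1 _)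
  simp only [hterm, Finset.prod_range_one, pow_zero, mul_one] at h
  exact h.symm

theorem summable_pow_choose_two {q : ℝ} (hq : 0 < q) (hq1 : q < 1) (x : ℝ) :
    Summable fun i : ℕ => q ^ i.choose 2 * x ^ i := by
  rcases eq_or_ne x 0 with rfl | hx
  · refine summable_of_ne_finset_zero (s := {0}) fun i hi => ?_
    rw [zero_pow (by simpa using hi), mul_zero]
  refine summable_of_ratio_test_tendsto_lt_one (l := 0) one_pos
    (Eventually.of_forall fun i => mul_ne_zero (pow_ne_zero _ hq.ne') (pow_ne_zero _ hx)) ?_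
  have h : Tendsto (fun i : ℕ => q ^ i * |x|) atTop (𝓝 (0 * |x|)) :=
    (tendsto_pow_atTop_nhds_zero_of_lt_one hq.le hq1).mul_const _
  rw [zero_mul] at h
  refine h.congr fun i => ?_
  rw [← norm_div, Nat.choose_succ_succ' i 1, Nat.choose_one_right, pow_add, pow_succ x,
    Real.norm_eq_abs]
  have : q ^ i * q ^ i.choose 2 * (x ^ i * x) / (q ^ i.choose 2 * x ^ i) = q ^ i * x := by
    have h1 : q ^ i.choose 2 ≠ 0 := pow_ne_zero _ hq.ne'
    have h2 : x ^ i ≠ 0 := pow_ne_zero _ hx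
    field_simp
  rw [this, abs_mul, abs_of_pos (pow_pos hq i)]

theorem summable_pow_succ_choose_two {q : ℝ} (hq : 0 < q) (hq1 : q < 1) (x : ℝ) :
    Summable fun i : ℕ => q ^ (i + 1).choose 2 * x ^ i := by
  refine (summable_pow_choose_two hq hq1 (q * x)).congr fun i => ?_
  rw [Nat.choose_succ_succ' i 1, Nat.choose_one_right, pow_add, mul_pow]
  ring

/-- The coefficients of Euler's expansion of `(x; q)_∞`. -/
def eulerCoeff (q : ℝ) (i : ℕ) : ℝ := (-1) ^ i * q ^ i.choose 2 / qPoch q q i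

theorem abs_eulerCoeff_le {q : ℝ} (hq : 0 < q) (hq1 : q < 1) (i : ℕ) :
    |eulerCoeff q i| ≤ (qPochInf q q)⁻¹ * q ^ i.choose 2 := by
  rw [eulerCoeff, abs_div, abs_mul, abs_pow, abs_neg, abs_one, one_pow, one_mul,
    abs_of_pos (pow_pos hq _), abs_of_pos (qPoch_self_pos hq hq1 i), div_eq_inv_mul]
  exact mul_le_mul_of_nonneg_right
    (inv_anti₀ (qPochInf_pos hq hq1 hq1) (qPochInf_le_qPoch hq hq1 hq.le hq1.le i))
    (pow_nonneg hq.le _)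

theorem summable_eulerCoeff {q : ℝ} (hq : 0 < q) (hq1 : q < 1) (x : ℝ) :
    Summable fun i : ℕ => eulerCoeff q i * x ^ i := by
  refine Summable.of_norm_bounded
    ((summable_pow_choose_two hq hq1 |x|).mul_left (qPochInf q q)⁻¹) fun i => ?_
  rw [Real.norm_eq_abs, abs_mul, abs_pow, ← mul_assoc]
  exact mul_le_mul_of_nonneg_right (abs_eulerCoeff_le hq hq1 i) (pow_nonneg (abs_nonneg x) i)

theorem eulerCoeff_succ {q : ℝ} (hq : 0 < q) (hq1 : q < 1) (i : ℕ) :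
    eulerCoeff q (i + 1) * (1 - q ^ (i + 1)) = -(q ^ i * eulerCoeff q i) := by
  have h1 := (qPoch_self_pos hq hq1 i).ne'
  have h2 : 1 - q ^ (i + 1) ≠ 0 := (sub_pos.2 (pow_lt_one₀ hq.le hq1 (Nat.succ_ne_zero i))).ne'
  have h3 : qPoch q q (i + 1) = qPoch q q i * (1 - q ^ (i + 1)) := by
    rw [qPoch_self, qPoch_self, Finset.prod_range_succ]
  rw [eulerCoeff, eulerCoeff, h3, Nat.choose_succ_succ' i 1, Nat.choose_one_right, pow_add]
  field_simp
  ring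

/-- Euler's expansion of `(x; q)_∞`. -/
theorem hasSum_qPochInf {q : ℝ} (hq : 0 < q) (hq1 : q < 1) (x : ℝ) :
    HasSum (fun i : ℕ => eulerCoeff q i * x ^ i) (qPochInf x q) := by
  set f : ℝ → ℝ := fun x => ∑' i : ℕ, eulerCoeff q i * x ^ i with hf
  have hs := summable_eulerCoeff hq hq1
  have h0 : eulerCoeff q 0 = 1 := by simp [eulerCoeff, qPoch]
  -- The coefficient recurrence is this functional equation. Its iteration yields the product `qPoch
  -- x q n`, and the remaining factor `f (x q ^ n)` tends to `f 0 = 1`.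
  have hfun : ∀ x, f x = (1 - x) * f (x * q) := by
    intro x
    have e1 : f x - f (x * q) = ∑' i : ℕ, eulerCoeff q i * (1 - q ^ i) * x ^ i := by
      rw [hf, ← (hs x).tsum_sub (hs (x * q))]
      exact tsum_congr fun i => by rw [mul_pow]; ring
    have e2 : Summable fun i : ℕ => eulerCoeff q i * (1 - q ^ i) * x ^ i := by
      refine ((hs x).sub (hs (x * q))).congr fun i => ?_
      rw [mul_pow]; ring
    rw [e2.tsum_eq_zero_add] at e1
    simp only [pow_zero, sub_self, mul_zero, zero_mul, zero_add, eulerCoeff_succ hq hq1] at e1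
    have e3 : ∑' i : ℕ, -(q ^ i * eulerCoeff q i) * x ^ (i + 1) = -(x * f (x * q)) := by
      rw [hf, ← tsum_mul_left, ← tsum_neg]
      exact tsum_congr fun i => by rw [mul_pow]; ring
    rw [e3] at e1
    linarith
  have hiter : ∀ n, f x = qPoch x q n * f (x * q ^ n) := by
    intro n
    induction n with
    | zero => simp [qPoch]
    | succ n ih =>
      rw [ih, hfun (x * q ^ n), qPoch, qPoch, Finset.prod_range_succ, pow_succ]
      ring_nf
  have hlim : Tendsto (fun n => f (x * q ^ n)) atTop (𝓝 1) := by
    have h1 : (1 : ℝ) = ∑' i : ℕ, eulerCoeff q i * (0 : ℝ) ^ i := by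
      rw [tsum_eq_single 0 (fun i hi => by rw [zero_pow hi, mul_zero]), h0]; simp
    rw [h1]
    refine tendsto_tsum_of_dominated_convergence (hs x).norm ?_ ?_
    · intro i
      have : Tendsto (fun n : ℕ => x * q ^ n) atTop (𝓝 (x * 0)) :=
        (tendsto_pow_atTop_nhds_zero_of_lt_one hq.le hq1).const_mul x
      rw [mul_zero] at this
      exact (this.pow i).const_mul _
    · refine Eventually.of_forall fun n i => ?_
      rw [norm_mul, norm_mul]
      refine mul_le_mul_of_nonneg_left ?_ (norm_nonneg _)
      rw [norm_pow, norm_pow, norm_mul]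
      refine pow_le_pow_left₀ (by positivity) ?_ i
      refine mul_le_of_le_one_right (norm_nonneg _) ?_
      rw [Real.norm_eq_abs, abs_of_pos (pow_pos hq n)]
      exact pow_le_one₀ hq.le hq1.le
  have h2 := (tendsto_qPoch hq hq1 x).mul hlim
  rw [mul_one] at h2
  have h3 : f x = qPochInf x q :=
    tendsto_nhds_unique (tendsto_const_nhds.congr hiter) h2
  rw [← h3]
  exact (hs x).hasSum

/-! ### The Hahn–Exton function as a power series in `q ^ ν` -/

/-- The coefficients of the power series of the Hahn–Exton function in `t = q ^ ν`. -/
def besselCoeff (s q : ℝ) (i : ℕ) : ℝ :=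
  qPochInf (s * q ^ (i + 1)) q * ((-1) ^ i * q ^ (i + 1).choose 2) /
    (qPochInf q q * qPoch q q i)

/-- Euler's expansion of `(s q ^ (i + 1); q)_∞` gives an absolutely convergent double series. Its
only mixed factor is `q ^ (i m)`, so exchanging `(s, m)` with `(t, i)` leaves it unchanged. -/
theorem tsum_besselCoeff_symm {q : ℝ} (hq : 0 < q) (hq1 : q < 1) (s t : ℝ) :
    ∑' i, besselCoeff s q i * t ^ i = ∑' i, besselCoeff t q i * s ^ i := by
  set F : ℝ → ℝ → ℕ → ℕ → ℝ := fun s t i m =>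
    (qPochInf q q)⁻¹ * ((eulerCoeff q i * q ^ i * t ^ i) * (eulerCoeff q m * q ^ m * s ^ m)
      * q ^ (i * m)) with hF
  have hch : ∀ i : ℕ, (i + 1).choose 2 = i + i.choose 2 := fun i => by
    rw [Nat.choose_succ_succ' i 1, Nat.choose_one_right]
  have hrow : ∀ s t i, ∑' m, F s t i m = besselCoeff s q i * t ^ i := by
    intro s t i
    have h := (hasSum_qPochInf hq hq1 (s * q ^ (i + 1))).mul_left
      ((qPochInf q q)⁻¹ * (eulerCoeff q i * q ^ i * t ^ i))
    have e : ∀ m, (qPochInf q q)⁻¹ * (eulerCoeff q i * q ^ i * t ^ i) *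
        (eulerCoeff q m * (s * q ^ (i + 1)) ^ m) = F s t i m := by
      intro m
      simp only [hF]
      rw [mul_pow, ← pow_mul, add_mul, one_mul, pow_add]
      ring
    simp only [e] at h
    rw [h.tsum_eq, besselCoeff, eulerCoeff, hch, pow_add q i (i.choose 2)]
    have h1 := (qPochInf_pos hq hq1 hq1).ne'
    have h2 := (qPoch_self_pos hq hq1 i).ne'
    field_simp
  have hsum : Summable (Function.uncurry (F s t)) := by
    have h1 : ∀ x, Summable fun i : ℕ => |eulerCoeff q i * q ^ i * x ^ i| := fun x => by
      refine (summable_eulerCoeff hq hq1 (q * x)).abs.congr fun i => ?_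
      rw [mul_pow, mul_assoc]
    have h2 := ((h1 t).mul_of_nonneg (h1 s) (fun _ => abs_nonneg _) (fun _ => abs_nonneg _)).mul_left
      (qPochInf q q)⁻¹
    refine Summable.of_norm_bounded h2 fun x => ?_
    obtain ⟨i, m⟩ := x
    simp only [hF, Function.uncurry_apply_pair, Real.norm_eq_abs]
    rw [abs_mul, abs_of_pos (inv_pos.2 (qPochInf_pos hq hq1 hq1)), abs_mul _ (q ^ (i * m)),
      abs_mul (eulerCoeff q i * q ^ i * t ^ i)]
    refine mul_le_mul_of_nonneg_left ?_ (inv_pos.2 (qPochInf_pos hq hq1 hq1)).le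
    refine mul_le_of_le_one_right (by positivity) ?_
    rw [abs_of_pos (pow_pos hq _)]
    exact pow_le_one₀ hq.le hq1.le
  calc ∑' i, besselCoeff s q i * t ^ i = ∑' i, ∑' m, F s t i m := by simp only [hrow]
    _ = ∑' m, ∑' i, F s t i m := hsum.tsum_comm.symm
    _ = ∑' m, ∑' i, F t s m i := by
        refine tsum_congr fun m => tsum_congr fun i => ?_
        simp only [hF]
        rw [mul_comm i m]
        ring
    _ = _ := by simp only [hrow]

/-- The power series `∑ g_i t ^ i` with `J_ν(2ξ; q) = ξ ^ ν ∑ g_i q ^ {ν i}`, `s = ξ²`. -/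
def besselSeries (s q t : ℝ) : ℝ := ∑' i, besselCoeff s q i * t ^ i

/-- The factor `q ^ m` in the defining series raises `m.choose 2` to `(m + 1).choose 2`, so that
series is `∑ besselCoeff (q ^ ν) q m * (ξ ^ 2) ^ m`. The symmetry converts it to powers of `q ^ ν`,
at every real `ν`, negative integers included. -/
theorem hahnExton_eq {ξ q : ℝ} (hq : 0 < q) (hq1 : q < 1) (ν : ℝ) :
    hahnExton ν (2 * ξ) q = ξ ^ ν * besselSeries (ξ ^ 2) q (q ^ ν) := by
  rw [besselSeries, tsum_besselCoeff_symm hq hq1, hahnExton, mul_div_cancel_left₀ ξ two_ne_zero]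
  congr 1
  refine tsum_congr fun m => ?_
  have e1 : q ^ (ν + 1 + m) = q ^ ν * q ^ (m + 1) := by
    rw [add_assoc, Real.rpow_add hq, ← Real.rpow_natCast q (m + 1)]
    push_cast
    rw [add_comm (1 : ℝ)]
  have e2 : q * (2 * ξ) ^ 2 / 4 = q * ξ ^ 2 := by ring
  rw [e1, e2, besselCoeff, Nat.choose_succ_succ' m 1, Nat.choose_one_right, pow_add, mul_pow]
  ring

theorem abs_besselCoeff_le {s q : ℝ} (hq : 0 < q) (hq1 : q < 1) (hs : 0 < s) (hs1 : s < 1)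
    (i : ℕ) : |besselCoeff s q i| ≤ ((qPochInf q q)⁻¹) ^ 2 * q ^ (i + 1).choose 2 := by
  have hx0 : 0 ≤ s * q ^ (i + 1) := by positivity
  have hx1 : s * q ^ (i + 1) ≤ 1 := by
    refine mul_le_one₀ hs1.le (by positivity) (pow_le_one₀ hq.le hq1.le)
  have hQ := qPochInf_pos hq hq1 hq1
  have hP := qPoch_self_pos hq hq1 i
  rw [besselCoeff, abs_div, abs_mul, abs_mul, abs_pow, abs_neg, abs_one, one_pow, one_mul,
    abs_of_pos (pow_pos hq _), abs_of_pos (mul_pos hQ hP),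
    abs_of_nonneg (qPochInf_nonneg hq hq1 hx1), div_eq_inv_mul, mul_inv, sq]
  have h1 : (qPoch q q i)⁻¹ ≤ (qPochInf q q)⁻¹ :=
    inv_anti₀ hQ (qPochInf_le_qPoch hq hq1 hq.le hq1.le i)
  have h2 := qPochInf_le_one hq hq1 hx0 hx1
  have h3 : (0 : ℝ) < q ^ (i + 1).choose 2 := pow_pos hq _
  refine mul_le_mul ?_ (mul_le_of_le_one_left h3.le h2) (mul_nonneg
    (qPochInf_nonneg hq hq1 hx1) h3.le) (by positivity)
  exact mul_le_mul_of_nonneg_left h1 (inv_pos.2 hQ).le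

theorem summable_besselCoeff_abs {s q : ℝ} (hq : 0 < q) (hq1 : q < 1) (hs : 0 < s) (hs1 : s < 1)
    (T : ℝ) (hT : 0 ≤ T) : Summable fun i => |besselCoeff s q i| * T ^ i := by
  refine Summable.of_nonneg_of_le (fun i => by positivity) (fun i => ?_)
    ((summable_pow_succ_choose_two hq hq1 T).mul_left (((qPochInf q q)⁻¹) ^ 2))
  rw [← mul_assoc]
  exact mul_le_mul_of_nonneg_right (abs_besselCoeff_le hq hq1 hs hs1 i) (by positivity)

theorem summable_besselCoeff {s q : ℝ} (hq : 0 < q) (hq1 : q < 1) (hs : 0 < s) (hs1 : s < 1)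
    (t : ℝ) : Summable fun i => besselCoeff s q i * t ^ i := by
  refine Summable.of_abs ((summable_besselCoeff_abs hq hq1 hs hs1 |t| (abs_nonneg t)).congr ?_)
  intro i
  rw [abs_mul, abs_pow]

theorem exists_besselSeries_bound {s q : ℝ} (hq : 0 < q) (hq1 : q < 1) (hs : 0 < s) (hs1 : s < 1)
    (T : ℝ) : ∃ B, 0 ≤ B ∧ ∀ t, |t| ≤ T → |besselSeries s q t| ≤ B := by
  rcases lt_or_ge T 0 with hT | hT
  · exact ⟨0, le_rfl, fun t ht => absurd (ht.trans_lt hT) (not_lt.2 (abs_nonneg t))⟩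
  have hsum := summable_besselCoeff_abs hq hq1 hs hs1 T hT
  refine ⟨∑' i, |besselCoeff s q i| * T ^ i, tsum_nonneg fun i => by positivity, fun t ht => ?_⟩
  rw [← Real.norm_eq_abs]
  refine tsum_of_norm_bounded hsum.hasSum fun i => ?_
  rw [Real.norm_eq_abs, abs_mul, abs_pow]
  exact mul_le_mul_of_nonneg_left (pow_le_pow_left₀ (abs_nonneg t) ht i) (abs_nonneg _)

theorem continuous_besselSeries {s q : ℝ} (hq : 0 < q) (hq1 : q < 1) (hs : 0 < s) (hs1 : s < 1) :
    Continuous (besselSeries s q) := by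
  refine continuous_iff_continuousAt.2 fun t => ?_
  refine tendsto_tsum_of_dominated_convergence
    (summable_besselCoeff_abs hq hq1 hs hs1 (|t| + 1) (by positivity)) ?_ ?_
  · intro i
    exact ((continuous_const.mul (continuous_pow i)).tendsto t)
  · filter_upwards [Metric.ball_mem_nhds t one_pos] with u hu i
    rw [Real.norm_eq_abs, abs_mul, abs_pow]
    refine mul_le_mul_of_nonneg_left (pow_le_pow_left₀ (abs_nonneg u) ?_ i) (abs_nonneg _)
    rw [Metric.mem_ball, Real.dist_eq] at hu
    have := abs_sub_abs_le_abs_sub u t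
    linarith

theorem besselCoeff_succ {s q : ℝ} (hq : 0 < q) (hq1 : q < 1) (i : ℕ) :
    besselCoeff s q (i + 1) * ((1 - q ^ (i + 1)) * (1 - s * q ^ (i + 1))) =
      -(q ^ (i + 1) * besselCoeff s q i) := by
  have h1 := (qPoch_self_pos hq hq1 i).ne'
  have h2 : 1 - q ^ (i + 1) ≠ 0 := (sub_pos.2 (pow_lt_one₀ hq.le hq1 (Nat.succ_ne_zero i))).ne'
  have h3 : qPoch q q (i + 1) = qPoch q q i * (1 - q ^ (i + 1)) := by
    rw [qPoch_self, qPoch_self, Finset.prod_range_succ]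
  have h4 := (qPochInf_pos hq hq1 hq1).ne'
  have h5 := qPochInf_eq_mul hq hq1 (s * q ^ (i + 1))
  rw [mul_assoc s, ← pow_succ] at h5
  rw [besselCoeff, besselCoeff, h3, h5, Nat.choose_succ_succ' (i + 1) 1, Nat.choose_one_right,
    pow_add]
  field_simp
  ring

/-- On `t ^ i` the combination of dilations acts by `1 + s q ^ (2 i) - (1 + s) q ^ i = (1 - q ^ i)
(1 - s q ^ i)`, which is the factor in `besselCoeff_succ`. It kills `i = 0` and shifts the other
coefficients by one, leaving `-q t` times the series at `q t`. -/
theorem besselSeries_recurrence {s q : ℝ} (hq : 0 < q) (hq1 : q < 1) (hs : 0 < s) (hs1 : s < 1)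
    (t : ℝ) : besselSeries s q t + s * besselSeries s q (q * (q * t)) =
      (1 - q * t + s) * besselSeries s q (q * t) := by
  have hsm := summable_besselCoeff hq hq1 hs hs1
  have e1 : besselSeries s q t + s * besselSeries s q (q * (q * t)) -
      (1 + s) * besselSeries s q (q * t) =
      ∑' i, besselCoeff s q i * ((1 - q ^ i) * (1 - s * q ^ i)) * t ^ i := by
    simp only [besselSeries]
    rw [← tsum_mul_left, ← tsum_mul_left, ← (hsm t).tsum_add ((hsm _).mul_left s),
      ← ((hsm t).add ((hsm _).mul_left s)).tsum_sub ((hsm _).mul_left (1 + s))]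
    refine tsum_congr fun i => ?_
    rw [mul_pow, mul_pow]
    ring
  have e2 : Summable fun i => besselCoeff s q i * ((1 - q ^ i) * (1 - s * q ^ i)) * t ^ i := by
    refine (((hsm t).add ((hsm (q * (q * t))).mul_left s)).sub
      ((hsm (q * t)).mul_left (1 + s))).congr fun i => ?_
    rw [mul_pow, mul_pow]
    ring
  rw [e2.tsum_eq_zero_add] at e1
  simp only [pow_zero, sub_self, mul_zero, zero_mul, zero_add, besselCoeff_succ hq hq1] at e1
  have e3 : ∑' i, -(q ^ (i + 1) * besselCoeff s q i) * t ^ (i + 1) =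
      -(q * t * besselSeries s q (q * t)) := by
    rw [besselSeries, ← tsum_mul_left, ← tsum_neg]
    refine tsum_congr fun i => ?_
    rw [mul_pow]
    ring
  rw [e3] at e1
  linarith

/-! ### The `q`-Bessel kernel as a series -/

/-- The function `q ^ {ν / 2} J_ν(2ξ; q)`. -/
def scaledBessel (ξ q ν : ℝ) : ℝ := (ξ * √q) ^ ν * besselSeries (ξ ^ 2) q (q ^ ν)

/-- The series `∑_l q ^ {(r + u + 1) / 2 + l} J_{r + 1/2 + l} J_{u + 1/2 + l}`. -/
def kernelSeries (ξ q r u : ℝ) : ℝ :=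
  ∑' l : ℕ, scaledBessel ξ q (r + 1 / 2 + l) * scaledBessel ξ q (u + 1 / 2 + l)

theorem scaledBessel_eq {ξ q : ℝ} (hξ : 0 < ξ) (hq : 0 < q) (hq1 : q < 1) (ν : ℝ) :
    scaledBessel ξ q ν = q ^ (ν / 2) * hahnExton ν (2 * ξ) q := by
  rw [scaledBessel, hahnExton_eq hq hq1, Real.mul_rpow hξ.le (Real.sqrt_nonneg q),
    Real.sqrt_eq_rpow, ← Real.rpow_mul hq.le]
  ring_nf

theorem mul_sqrt_pos {ξ q : ℝ} (hξ : 0 < ξ) (hq : 0 < q) : 0 < ξ * √q :=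
  mul_pos hξ (Real.sqrt_pos.2 hq)

theorem mul_sqrt_lt_one {ξ q : ℝ} (hξ : 0 < ξ) (hξ1 : ξ < 1) (hq1 : q < 1) : ξ * √q < 1 := by
  have h : √q ≤ 1 := Real.sqrt_le_one.2 hq1.le
  exact (mul_le_of_le_one_right hξ.le h).trans_lt hξ1

theorem exists_besselSeries_rpow_bound {s q : ℝ} (hq : 0 < q) (hq1 : q < 1) (hs : 0 < s)
    (hs1 : s < 1) (ν₀ : ℝ) : ∃ B, 0 ≤ B ∧ ∀ ν, ν₀ ≤ ν → |besselSeries s q (q ^ ν)| ≤ B := by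
  obtain ⟨B, hB, h⟩ := exists_besselSeries_bound hq hq1 hs hs1 (q ^ ν₀)
  refine ⟨B, hB, fun ν hν => h _ ?_⟩
  rw [abs_of_pos (Real.rpow_pos_of_pos hq ν)]
  exact Real.rpow_le_rpow_of_exponent_ge hq hq1.le hν

/-- The geometric decay comes from the prefactor `(ξ √q) ^ ν`. The bound is uniform in `ν ≥ ν₀`, as
needed for dominated convergence when one argument of the kernel moves. -/
theorem exists_scaledBessel_bound {ξ q : ℝ} (hξ : 0 < ξ) (hξ1 : ξ < 1) (hq : 0 < q) (hq1 : q < 1)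
    (ν₀ : ℝ) : ∃ B, 0 ≤ B ∧ ∀ ν, ν₀ ≤ ν → ∀ l : ℕ,
      |scaledBessel ξ q (ν + l)| ≤ B * (ξ * √q) ^ l := by
  have hc := mul_sqrt_pos hξ hq
  have hc1 := mul_sqrt_lt_one hξ hξ1 hq1
  obtain ⟨B, hB, h⟩ := exists_besselSeries_rpow_bound hq hq1 (pow_pos hξ 2)
    (pow_lt_one₀ hξ.le hξ1 two_ne_zero) ν₀
  refine ⟨(ξ * √q) ^ ν₀ * B, by positivity, fun ν hν l => ?_⟩
  have h1 := h (ν + l) (hν.trans (le_add_of_nonneg_right (Nat.cast_nonneg l)))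
  have h2 : (ξ * √q) ^ ν ≤ (ξ * √q) ^ ν₀ := Real.rpow_le_rpow_of_exponent_ge hc hc1.le hν
  rw [scaledBessel, abs_mul, abs_of_pos (Real.rpow_pos_of_pos hc _), Real.rpow_add hc,
    Real.rpow_natCast]
  calc (ξ * √q) ^ ν * (ξ * √q) ^ l * |besselSeries (ξ ^ 2) q (q ^ (ν + l))|
      ≤ (ξ * √q) ^ ν₀ * (ξ * √q) ^ l * B := by gcongr
    _ = _ := by ring

theorem summable_geometric_mul_self {c : ℝ} (hc : 0 < c) (hc1 : c < 1) (B B' : ℝ) :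
    Summable fun l : ℕ => B * c ^ l * (B' * c ^ l) := by
  have h : c ^ 2 < 1 := pow_lt_one₀ hc.le hc1 two_ne_zero
  refine ((summable_geometric_of_lt_one (sq_nonneg c) h).mul_left (B * B')).congr fun l => ?_
  rw [← pow_mul, mul_comm 2 l, pow_mul]
  ring

theorem summable_kernelSeries {ξ q : ℝ} (hξ : 0 < ξ) (hξ1 : ξ < 1) (hq : 0 < q) (hq1 : q < 1)
    (r u : ℝ) : Summable fun l : ℕ =>
      scaledBessel ξ q (r + 1 / 2 + l) * scaledBessel ξ q (u + 1 / 2 + l) := by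
  obtain ⟨B, hB, h⟩ := exists_scaledBessel_bound hξ hξ1 hq hq1 (r + 1 / 2)
  obtain ⟨B', hB', h'⟩ := exists_scaledBessel_bound hξ hξ1 hq hq1 (u + 1 / 2)
  refine Summable.of_norm_bounded (summable_geometric_mul_self (mul_sqrt_pos hξ hq)
    (mul_sqrt_lt_one hξ hξ1 hq1) B B') fun l => ?_
  rw [norm_mul]
  have hc := mul_sqrt_pos hξ hq
  exact mul_le_mul (h _ le_rfl l) (h' _ le_rfl l) (norm_nonneg _) (by positivity)

/-- The three-term recurrence of the Hahn–Exton function. -/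
theorem hahnExton_recurrence {ξ q : ℝ} (hξ : 0 < ξ) (hξ1 : ξ < 1) (hq : 0 < q) (hq1 : q < 1)
    (ν : ℝ) : ξ * (hahnExton (ν - 1) (2 * ξ) q + hahnExton (ν + 1) (2 * ξ) q) =
      (1 - q ^ ν + ξ ^ 2) * hahnExton ν (2 * ξ) q := by
  have h := besselSeries_recurrence hq hq1 (pow_pos hξ 2) (pow_lt_one₀ hξ.le hξ1 two_ne_zero)
    (q ^ (ν - 1))
  have e1 : q * q ^ (ν - 1) = q ^ ν := by rw [Real.rpow_sub_one hq.ne']; field_simp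
  have e2 : q * q ^ ν = q ^ (ν + 1) := by rw [Real.rpow_add_one hq.ne', mul_comm]
  rw [e1, e2] at h
  rw [hahnExton_eq hq hq1, hahnExton_eq hq hq1, hahnExton_eq hq hq1, Real.rpow_add_one hξ.ne',
    Real.rpow_sub_one hξ.ne']
  have e3 : ξ * (ξ ^ ν / ξ) = ξ ^ ν := by field_simp
  linear_combination ξ ^ ν * h + besselSeries (ξ ^ 2) q (q ^ (ν - 1)) * e3

theorem tendsto_hahnExton_atTop {ξ q : ℝ} (hξ : 0 < ξ) (hξ1 : ξ < 1) (hq : 0 < q) (hq1 : q < 1)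
    (ν : ℝ) : Tendsto (fun l : ℕ => hahnExton (ν + l) (2 * ξ) q) atTop (𝓝 0) := by
  obtain ⟨B, hB, h⟩ := exists_besselSeries_rpow_bound hq hq1 (pow_pos hξ 2)
    (pow_lt_one₀ hξ.le hξ1 two_ne_zero) ν
  have hlim : Tendsto (fun l : ℕ => ξ ^ ν * B * ξ ^ l) atTop (𝓝 (ξ ^ ν * B * 0)) :=
    (tendsto_pow_atTop_nhds_zero_of_lt_one hξ.le hξ1).const_mul _
  rw [mul_zero] at hlim
  refine squeeze_zero_norm (fun l => ?_) hlim
  rw [hahnExton_eq hq hq1, Real.norm_eq_abs, abs_mul, abs_of_pos (Real.rpow_pos_of_pos hξ _),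
    Real.rpow_add hξ, Real.rpow_natCast, mul_right_comm (ξ ^ ν) B]
  exact mul_le_mul_of_nonneg_left (h _ (le_add_of_nonneg_right (Nat.cast_nonneg l)))
    (by positivity)

/-- A Christoffel–Darboux argument: the recurrence at `ν = r + 1/2 + l` times `J_μ`, subtracted from
the one at `μ = u + 1/2 + l` times `J_ν`, writes `(q ^ ν - q ^ μ) J_ν J_μ` as `D l - D (l + 1)`. The
series telescopes to the numerator `D 0`, because `D` tends to zero. -/
theorem kernelQuotient_eq_kernelSeries {ξ q : ℝ} (hξ : 0 < ξ) (hξ1 : ξ < 1) (hq : 0 < q)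
    (hq1 : q < 1) {r u : ℝ} (hru : r ≠ u) : kernelQuotient ξ q r u = kernelSeries ξ q r u := by
  set J : ℝ → ℝ := fun ν => hahnExton ν (2 * ξ) q with hJ
  set D : ℕ → ℝ := fun l => ξ * (J (r + 1 / 2 + l) * J (u + 1 / 2 + l - 1) -
    J (r + 1 / 2 + l - 1) * J (u + 1 / 2 + l)) with hD
  set δ : ℝ := q ^ ((r - u) / 2) - q ^ (-((r - u) / 2)) with hδ
  have hδ0 : δ ≠ 0 := by
    rw [hδ, sub_ne_zero]
    intro h
    have h2 := (Real.rpow_right_inj hq hq1.ne).1 h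
    exact hru (by linarith)
  have hstep : ∀ l, D l - D (l + 1) =
      δ * (scaledBessel ξ q (r + 1 / 2 + l) * scaledBessel ξ q (u + 1 / 2 + l)) := by
    intro l
    have h1 := hahnExton_recurrence hξ hξ1 hq hq1 (r + 1 / 2 + l)
    have h2 := hahnExton_recurrence hξ hξ1 hq hq1 (u + 1 / 2 + l)
    have e1 : r + 1 / 2 + ((l + 1 : ℕ) : ℝ) = r + 1 / 2 + l + 1 := by push_cast; ring
    have e2 : u + 1 / 2 + ((l + 1 : ℕ) : ℝ) = u + 1 / 2 + l + 1 := by push_cast; ring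
    rw [scaledBessel_eq hξ hq hq1, scaledBessel_eq hξ hq hq1]
    simp only [hD, e1, e2, add_sub_cancel_right]
    -- Since `ν - μ = r - u` for every `l`, the same `δ` satisfies `δ q ^ ((ν + μ) / 2) = q ^ ν - q
    -- ^ μ` at each step.
    have p1 : q ^ ((r - u) / 2) * (q ^ ((r + 1 / 2 + l) / 2) * q ^ ((u + 1 / 2 + l) / 2)) =
        q ^ (r + 1 / 2 + l) := by
      rw [← Real.rpow_add hq, ← Real.rpow_add hq]; congr 1; ring
    have p2 : q ^ (-((r - u) / 2)) * (q ^ ((r + 1 / 2 + l) / 2) * q ^ ((u + 1 / 2 + l) / 2)) =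
        q ^ (u + 1 / 2 + l) := by
      rw [← Real.rpow_add hq, ← Real.rpow_add hq]; congr 1; ring
    have h3 : δ * (q ^ ((r + 1 / 2 + l) / 2) * hahnExton (r + 1 / 2 + l) (2 * ξ) q *
        (q ^ ((u + 1 / 2 + l) / 2) * hahnExton (u + 1 / 2 + l) (2 * ξ) q)) =
        (q ^ (r + 1 / 2 + l) - q ^ (u + 1 / 2 + l)) * (J (r + 1 / 2 + l) * J (u + 1 / 2 + l)) := by
      rw [← p1, ← p2, hδ]; ring
    rw [h3]
    simp only [hJ]
    linear_combination (hahnExton (r + 1 / 2 + l) (2 * ξ) q) * h2 -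
      (hahnExton (u + 1 / 2 + l) (2 * ξ) q) * h1
  have hDlim : Tendsto D atTop (𝓝 0) := by
    have t := tendsto_hahnExton_atTop hξ hξ1 hq hq1
    have t1 : ∀ ν, Tendsto (fun l : ℕ => J (ν + l - 1)) atTop (𝓝 0) := fun ν =>
      (t (ν - 1)).congr fun l => by rw [add_sub_right_comm]
    have := (((t (r + 1 / 2)).mul (t1 (u + 1 / 2))).sub
      ((t1 (r + 1 / 2)).mul (t (u + 1 / 2)))).const_mul ξ
    rw [mul_zero, sub_zero, mul_zero] at this
    exact this
  have hs := (summable_kernelSeries hξ hξ1 hq hq1 r u).mul_left δ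
  have h1 := hs.hasSum.tendsto_sum_nat
  have h2 : Tendsto (fun n => ∑ l ∈ Finset.range n,
      δ * (scaledBessel ξ q (r + 1 / 2 + l) * scaledBessel ξ q (u + 1 / 2 + l))) atTop
      (𝓝 (D 0 - 0)) := by
    refine (tendsto_const_nhds.sub hDlim).congr fun n => ?_
    rw [← Finset.sum_range_sub']
    exact Finset.sum_congr rfl fun l _ => hstep l
  have h3 := tendsto_nhds_unique h2 h1
  rw [tsum_mul_left, sub_zero] at h3
  rw [kernelQuotient, kernelSeries, div_eq_iff hδ0, mul_comm (tsum _), ← h3]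
  simp only [hD, hJ, Nat.cast_zero, add_zero]
  have e1 : r + 1 / 2 - 1 = r - 1 / 2 := by ring
  have e2 : u + 1 / 2 - 1 = u - 1 / 2 := by ring
  rw [e1, e2]

theorem tendsto_kernelSeries {ξ q : ℝ} (hξ : 0 < ξ) (hξ1 : ξ < 1) (hq : 0 < q) (hq1 : q < 1)
    (r : ℝ) : Tendsto (fun u => kernelSeries ξ q r u) (𝓝 r) (𝓝 (kernelSeries ξ q r r)) := by
  have hc := mul_sqrt_pos hξ hq
  -- For `|u - r| < 1` both `r + 1/2` and `u + 1/2` are at least `r - 1/2`.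
  obtain ⟨B, hB, h⟩ := exists_scaledBessel_bound hξ hξ1 hq hq1 (r - 1 / 2)
  refine tendsto_tsum_of_dominated_convergence (summable_geometric_mul_self hc
    (mul_sqrt_lt_one hξ hξ1 hq1) B B) ?_ ?_
  · intro l
    refine Tendsto.const_mul _ ?_
    have hcont : Continuous (scaledBessel ξ q) := by
      refine Continuous.mul (Real.continuous_const_rpow hc.ne') ?_
      exact (continuous_besselSeries hq hq1 (pow_pos hξ 2)
        (pow_lt_one₀ hξ.le hξ1 two_ne_zero)).comp (Real.continuous_const_rpow hq.ne')
    exact (hcont.comp (by fun_prop : Continuous fun u : ℝ => u + 1 / 2 + (l : ℝ))).tendsto r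
  · filter_upwards [Metric.ball_mem_nhds r one_pos] with u hu l
    rw [Metric.mem_ball, Real.dist_eq, abs_lt] at hu
    rw [norm_mul]
    exact mul_le_mul (h _ (by linarith) l) (h _ (by linarith) l) (norm_nonneg _) (by positivity)

theorem tendsto_kernelQuotient {ξ q : ℝ} (hξ : 0 < ξ) (hξ1 : ξ < 1) (hq : 0 < q) (hq1 : q < 1)
    (r : ℝ) : Tendsto (fun u => kernelQuotient ξ q r u) (𝓝[≠] r) (𝓝 (kernelSeries ξ q r r)) := by
  refine ((tendsto_kernelSeries hξ hξ1 hq hq1 r).mono_left nhdsWithin_le_nhds).congr' ?_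
  filter_upwards [self_mem_nhdsWithin] with u hu
  exact (kernelQuotient_eq_kernelSeries hξ hξ1 hq hq1 (Ne.symm hu)).symm

theorem qBesselKernel_eq_kernelSeries {ξ q : ℝ} (hξ : 0 < ξ) (hξ1 : ξ < 1) (hq : 0 < q)
    (hq1 : q < 1) (r u : ℝ) : qBesselKernel ξ q r u = kernelSeries ξ q r u := by
  rw [qBesselKernel]
  split_ifs with h
  · subst h
    exact (tendsto_kernelQuotient hξ hξ1 hq hq1 r).limUnder_eq
  · exact kernelQuotient_eq_kernelSeries hξ hξ1 hq hq1 h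

/-! ### The kernel of the ensemble with `N` rows -/

/-- The parameters `c q ^ i` of the ensemble with `N` rows. -/
def geomParam (c q : ℝ) (N : ℕ) (i : Fin N) : ℝ := c * q ^ (i : ℕ)

/-- The analogue of `besselCoeff` for the ensemble with `N` rows. -/
def finiteCoeff (s q : ℝ) (N i : ℕ) : ℝ :=
  if i < N then qPoch (s * q ^ (i + 1)) q N * ((-1) ^ i * q ^ (i + 1).choose 2) /
    (qPoch q q (N - 1 - i) * qPoch q q i) else 0

theorem prod_erase_fin {N : ℕ} (i : Fin N) (f : ℕ → ℝ) :
    ∏ j ∈ Finset.univ.erase i, f j =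
      (∏ j ∈ Finset.range i, f j) * ∏ k ∈ Finset.range (N - 1 - i), f (i + 1 + k) := by
  have h1 : ∏ j ∈ Finset.univ.erase i, f j = ∏ j : Fin N, if (j : ℕ) = i then 1 else f j := by
    rw [← Finset.prod_erase Finset.univ (a := i) (by simp)]
    refine Finset.prod_congr rfl fun j hj => ?_
    rw [if_neg fun h => Finset.ne_of_mem_erase hj (Fin.ext h)]
  have hN : Finset.range N = Finset.range (i + 1 + (N - 1 - i)) := by
    congr 1
    have := i.isLt
    omega
  rw [h1, ← Finset.prod_range (fun j => if j = (i : ℕ) then 1 else f j), hN,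
    Finset.prod_range_add, Finset.prod_range_succ, if_pos rfl, mul_one]
  congr 1
  · exact Finset.prod_congr rfl fun j hj => if_neg (Finset.mem_range.1 hj).ne
  · exact Finset.prod_congr rfl fun j _ => if_neg (by omega)

/-- For `j > i` the factor is `a_i (1 - q ^ (j - i))`; for `j < i` it is `-a_i q ^ (-(i - j)) (1 - q
^ (i - j))`. The sign and the negative powers of `q` are moved to the left, where they form `(-1) ^
i * q ^ (i + 1).choose 2`. -/
theorem prod_geomParam_sub {c q : ℝ} {N : ℕ} (i : Fin N) :
    (∏ j ∈ Finset.univ.erase i, (geomParam c q N i - geomParam c q N j)) *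
        ((-1) ^ (i : ℕ) * q ^ ((i : ℕ) + 1).choose 2) =
      geomParam c q N i ^ (N - 1) * (qPoch q q (N - 1 - i) * qPoch q q i) := by
  have h := prod_erase_fin i fun j => c * q ^ (i : ℕ) - c * q ^ j
  have h1 : ∀ n : ℕ, (∏ j ∈ Finset.range n, (c * q ^ n - c * q ^ j)) *
      ((-1) ^ n * q ^ (n + 1).choose 2) = (c * q ^ n) ^ n * qPoch q q n := by
    intro n
    have e1 : (-1 : ℝ) ^ n = ∏ j ∈ Finset.range n, (-1 : ℝ) := by simp
    have e2 : q ^ (n + 1).choose 2 = ∏ j ∈ Finset.range n, q ^ (j + 1) := by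
      rw [Finset.prod_pow_eq_pow_sum]
      congr 1
      clear e1
      induction n with
      | zero => rfl
      | succ n ih => rw [Finset.sum_range_succ, ← ih, Nat.choose_succ_succ' (n + 1) 1,
          Nat.choose_one_right, add_comm]
    have e3 : (c * q ^ n) ^ n = ∏ j ∈ Finset.range n, (c * q ^ n) := by simp
    rw [e1, e2, e3, qPoch_self, ← Finset.prod_range_reflect (fun j => q ^ (j + 1)),
      ← Finset.prod_range_reflect (fun j => 1 - q ^ (j + 1)), ← Finset.prod_mul_distrib,
      ← Finset.prod_mul_distrib, ← Finset.prod_mul_distrib]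
    refine Finset.prod_congr rfl fun j hj => ?_
    have hj' := Finset.mem_range.1 hj
    have hn : q ^ n = q ^ j * q ^ (n - 1 - j + 1) := by
      rw [← pow_add]
      congr 1
      omega
    rw [hn]
    ring
  have h2 : ∏ k ∈ Finset.range (N - 1 - i), (c * q ^ (i : ℕ) - c * q ^ ((i : ℕ) + 1 + k)) =
      (c * q ^ (i : ℕ)) ^ (N - 1 - i) * qPoch q q (N - 1 - i) := by
    have e : (c * q ^ (i : ℕ)) ^ (N - 1 - i) =
        ∏ j ∈ Finset.range (N - 1 - i), (c * q ^ (i : ℕ)) := by simp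
    rw [e, qPoch_self, ← Finset.prod_mul_distrib]
    refine Finset.prod_congr rfl fun k _ => ?_
    rw [add_assoc, pow_add, add_comm 1 k]
    ring
  have hN : N - 1 = i + (N - 1 - i) := by have := i.isLt; omega
  have h3 : (c * q ^ (i : ℕ)) ^ (N - 1) =
      (c * q ^ (i : ℕ)) ^ (i : ℕ) * (c * q ^ (i : ℕ)) ^ (N - 1 - i) := by
    rw [← pow_add, ← hN]
  simp only [geomParam]
  rw [h, h2, h3]
  linear_combination (c * q ^ (i : ℕ)) ^ (N - 1 - i) * qPoch q q (N - 1 - i) * h1 i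

section

variable {c s q : ℝ} {N : ℕ}

theorem geomParam_mul (hc2 : c ^ 2 = s * q) (i j : Fin N) :
    geomParam c q N i * geomParam c q N j = s * q ^ ((i : ℕ) + 1) * q ^ (j : ℕ) := by
  simp only [geomParam]
  linear_combination q ^ (i : ℕ) * q ^ (j : ℕ) * hc2

theorem geomParam_mul_pos (hc : 0 < c) (hq : 0 < q) (i j : Fin N) :
    0 < geomParam c q N i * geomParam c q N j := by
  simp only [geomParam]
  positivity

theorem geomParam_mul_lt_one (hc : 0 < c) (hc1 : c < 1) (hq : 0 < q) (hq1 : q < 1)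
    (i j : Fin N) : geomParam c q N i * geomParam c q N j < 1 := by
  have h : ∀ i, geomParam c q N i < 1 := fun i =>
    (mul_le_of_le_one_right hc.le (pow_le_one₀ hq.le hq1.le)).trans_lt hc1
  have h0 : 0 < geomParam c q N i := by simp only [geomParam]; positivity
  have h0' : 0 < geomParam c q N j := by simp only [geomParam]; positivity
  exact mul_lt_one_of_nonneg_of_lt_one_left h0.le (h i) (h j).le

theorem geomParam_injective (hc : 0 < c) (hq : 0 < q) (hq1 : q < 1) :
    Function.Injective (geomParam c q N) := by
  intro i j h
  have h2 := mul_left_cancel₀ hc.ne' h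
  exact Fin.ext (pow_right_injective₀ hq hq1.ne h2)

/-- The power `a_i ^ (N - 1)` cancels the homogeneous part of `∏_{j ≠ i} (a_i - a_j)`; what remains
has a limit as `N → ∞`. -/
theorem cauchyCoeff_mul_pow (hc : 0 < c) (hq : 0 < q) (hq1 : q < 1) (hc2 : c ^ 2 = s * q)
    (i : Fin N) : cauchyCoeff (geomParam c q N) i * geomParam c q N i ^ (N - 1) =
      finiteCoeff s q N i := by
  have h := prod_geomParam_sub (c := c) (q := q) i
  have h0 : (∏ j ∈ Finset.univ.erase i, (geomParam c q N i - geomParam c q N j)) ≠ 0 := by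
    refine Finset.prod_ne_zero_iff.2 fun j hj => sub_ne_zero.2 fun he => ?_
    exact Finset.ne_of_mem_erase hj (geomParam_injective hc hq hq1 he).symm
  have h1 := (qPoch_self_pos hq hq1 (N - 1 - i)).ne'
  have h2 := (qPoch_self_pos hq hq1 i).ne'
  have h3 : ∏ j, (1 - geomParam c q N i * geomParam c q N j) =
      qPoch (s * q ^ ((i : ℕ) + 1)) q N := by
    rw [qPoch, Finset.prod_range]
    exact Finset.prod_congr rfl fun j _ => by rw [geomParam_mul hc2]
  rw [finiteCoeff, if_pos i.isLt, cauchyCoeff, h3, eq_div_iff (mul_ne_zero h1 h2), mul_assoc,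
    mul_assoc, ← h, inv_mul_cancel_left₀ h0]

theorem abs_finiteCoeff_le (hq : 0 < q) (hq1 : q < 1) (hs : 0 < s) (hs1 : s < 1) (N i : ℕ) :
    |finiteCoeff s q N i| ≤ ((qPochInf q q)⁻¹) ^ 2 * q ^ (i + 1).choose 2 := by
  have hQ := qPochInf_pos hq hq1 hq1
  rw [finiteCoeff]
  split_ifs
  · have hx0 : 0 ≤ s * q ^ (i + 1) := by positivity
    have hx1 : s * q ^ (i + 1) ≤ 1 :=
      mul_le_one₀ hs1.le (by positivity) (pow_le_one₀ hq.le hq1.le)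
    have hP := qPoch_self_pos hq hq1 i
    have hP' := qPoch_self_pos hq hq1 (N - 1 - i)
    rw [abs_div, abs_mul, abs_mul, abs_pow, abs_neg, abs_one, one_pow, one_mul,
      abs_of_pos (pow_pos hq _), abs_of_pos (mul_pos hP' hP),
      abs_of_nonneg (qPoch_nonneg hq hq1 hx1 N), div_eq_inv_mul, mul_inv, sq]
    have h1 : ∀ n, (qPoch q q n)⁻¹ ≤ (qPochInf q q)⁻¹ := fun n =>
      inv_anti₀ hQ (qPochInf_le_qPoch hq hq1 hq.le hq1.le n)
    have h2 : qPoch (s * q ^ (i + 1)) q N ≤ 1 := by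
      simpa [qPoch] using qPoch_antitone hq hq1 hx0 hx1 (Nat.zero_le N)
    have h3 : (0 : ℝ) < q ^ (i + 1).choose 2 := pow_pos hq _
    refine mul_le_mul ?_ (mul_le_of_le_one_left h3.le h2) (mul_nonneg
      (qPoch_nonneg hq hq1 hx1 N) h3.le) (by positivity)
    exact mul_le_mul (h1 _) (h1 _) (inv_pos.2 hP).le (inv_pos.2 hQ).le
  · rw [abs_zero]
    positivity

theorem tendsto_finiteCoeff (hq : 0 < q) (hq1 : q < 1) (i : ℕ) :
    Tendsto (fun N => finiteCoeff s q N i) atTop (𝓝 (besselCoeff s q i)) := by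
  have h1 : Tendsto (fun N => qPoch q q (N - 1 - i)) atTop (𝓝 (qPochInf q q)) := by
    refine (tendsto_qPoch hq hq1 q).comp ?_
    refine tendsto_atTop.2 fun b => ?_
    filter_upwards [eventually_ge_atTop (b + 1 + i)] with N hN
    omega
  have h2 := ((tendsto_qPoch hq hq1 (s * q ^ (i + 1))).mul_const
    ((-1) ^ i * q ^ (i + 1).choose 2)).div (h1.mul_const (qPoch q q i))
    (mul_pos (qPochInf_pos hq hq1 hq1) (qPoch_self_pos hq hq1 i)).ne'
  refine h2.congr' ?_
  filter_upwards [eventually_gt_atTop i] with N hN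
  rw [finiteCoeff, if_pos hN]
  rfl

/-- The analogue of `besselSeries` for the ensemble with `N` rows. -/
def finiteSeries (s q : ℝ) (N : ℕ) (t : ℝ) : ℝ := ∑' i, finiteCoeff s q N i * t ^ i

theorem tendsto_finiteSeries (hq : 0 < q) (hq1 : q < 1) (hs : 0 < s) (hs1 : s < 1) (t : ℝ) :
    Tendsto (fun N => finiteSeries s q N t) atTop (𝓝 (besselSeries s q t)) := by
  refine tendsto_tsum_of_dominated_convergence
    ((summable_pow_succ_choose_two hq hq1 |t|).mul_left (((qPochInf q q)⁻¹) ^ 2))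
    (fun i => (tendsto_finiteCoeff hq hq1 i).mul_const _)
    (Eventually.of_forall fun N i => ?_)
  rw [Real.norm_eq_abs, abs_mul, abs_pow, ← mul_assoc]
  exact mul_le_mul_of_nonneg_right (abs_finiteCoeff_le hq hq1 hs hs1 N i) (by positivity)

theorem exists_finiteSeries_bound (hq : 0 < q) (hq1 : q < 1) (hs : 0 < s) (hs1 : s < 1)
    (T : ℝ) (hT : 0 ≤ T) : ∃ B, 0 ≤ B ∧ ∀ N t, |t| ≤ T → |finiteSeries s q N t| ≤ B := by
  have hsum := (summable_pow_succ_choose_two hq hq1 T).mul_left (((qPochInf q q)⁻¹) ^ 2)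
  refine ⟨∑' i : ℕ, ((qPochInf q q)⁻¹) ^ 2 * (q ^ (i + 1).choose 2 * T ^ i),
    tsum_nonneg fun i => by positivity, fun N t ht => ?_⟩
  rw [← Real.norm_eq_abs]
  refine tsum_of_norm_bounded hsum.hasSum fun i => ?_
  rw [Real.norm_eq_abs, abs_mul, abs_pow, ← mul_assoc]
  exact mul_le_mul (abs_finiteCoeff_le hq hq1 hs hs1 N i)
    (pow_le_pow_left₀ (abs_nonneg t) ht i) (by positivity) (by positivity)

/-- Of the exponent `x = n + (N - 1)`, the part `N - 1` normalizes `cauchyCoeff`, and `a_i ^ n = c ^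
n (q ^ n) ^ i` makes the sum a power series in `q ^ n`. The integer `n` may be negative. -/
theorem sum_cauchyCoeff_mul_pow (hc : 0 < c) (hq : 0 < q) (hq1 : q < 1) (hc2 : c ^ 2 = s * q)
    (x : ℕ) (n : ℤ) (hx : (x : ℤ) = n + (N - 1)) :
    ∑ i, cauchyCoeff (geomParam c q N) i * geomParam c q N i ^ x =
      c ^ n * finiteSeries s q N (q ^ n) := by
  rw [finiteSeries, tsum_eq_sum (s := Finset.range N) (fun i hi => by
    rw [finiteCoeff, if_neg (by simpa using hi), zero_mul]), Finset.sum_range, Finset.mul_sum]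
  refine Finset.sum_congr rfl fun i _ => ?_
  have hN := i.pos
  have h0 : geomParam c q N i ≠ 0 := by simp only [geomParam]; positivity
  have h1 : geomParam c q N i ^ x = geomParam c q N i ^ n * geomParam c q N i ^ (N - 1) := by
    rw [← zpow_natCast, ← zpow_natCast, ← zpow_add₀ h0]
    congr 1
    omega
  have h2 : geomParam c q N i ^ n = c ^ n * (q ^ n) ^ (i : ℕ) := by
    rw [geomParam, mul_zpow, ← zpow_natCast, ← zpow_natCast, ← zpow_mul, ← zpow_mul, mul_comm n]
  rw [h1, h2, ← cauchyCoeff_mul_pow hc hq hq1 hc2]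
  ring

/-- The kernel of the ensemble with `N` rows. -/
def finiteKernel (c s q : ℝ) (N : ℕ) (x y : ℤ) : ℝ :=
  ∑' l : ℕ, (c ^ (x + 1 + l) * finiteSeries s q N (q ^ (x + 1 + l))) *
    (c ^ (y + 1 + l) * finiteSeries s q N (q ^ (y + 1 + l)))

/-- Expanding `(1 - a_i a_j)⁻¹ = ∑_l (a_i a_j) ^ l` separates `i` from `j`. Each `l` contributes a
product of two sums as in `sum_cauchyCoeff_mul_pow`, with `x + l = (m + 1 + l) + (N - 1)`. -/
theorem sum_cauchyGram_inv (hc : 0 < c) (hc1 : c < 1) (hq : 0 < q) (hq1 : q < 1)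
    (hc2 : c ^ 2 = s * q) (x y : ℕ) (m n : ℤ) (hx : (x : ℤ) = m + N) (hy : (y : ℤ) = n + N) :
    ∑ i, ∑ j, geomParam c q N i ^ x *
      (Matrix.diagonal (cauchyCoeff (geomParam c q N)) * cauchyGram (geomParam c q N) *
        Matrix.diagonal (cauchyCoeff (geomParam c q N)) : Matrix (Fin N) (Fin N) ℝ) i j *
          geomParam c q N j ^ y = finiteKernel c s q N m n := by
  set a := geomParam c q N with ha
  have hsum : HasSum (fun l : ℕ => ∑ i, ∑ j, cauchyCoeff a i * a i ^ x *
      (cauchyCoeff a j * a j ^ y) * (a i * a j) ^ l)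
      (∑ i, ∑ j, cauchyCoeff a i * a i ^ x * (cauchyCoeff a j * a j ^ y) *
        (1 - a i * a j)⁻¹) := by
    refine hasSum_sum fun i _ => hasSum_sum fun j _ => HasSum.mul_left _ ?_
    exact hasSum_geometric_of_lt_one (geomParam_mul_pos hc hq i j).le
      (geomParam_mul_lt_one hc hc1 hq hq1 i j)
  have h1 : ∑ i, ∑ j, a i ^ x * (Matrix.diagonal (cauchyCoeff a) * cauchyGram a *
        Matrix.diagonal (cauchyCoeff a) : Matrix (Fin N) (Fin N) ℝ) i j * a j ^ y =
      ∑ i, ∑ j, cauchyCoeff a i * a i ^ x * (cauchyCoeff a j * a j ^ y) *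
        (1 - a i * a j)⁻¹ := by
    refine Finset.sum_congr rfl fun i _ => Finset.sum_congr rfl fun j _ => ?_
    rw [Matrix.mul_diagonal, Matrix.diagonal_mul, cauchyGram, Matrix.of_apply]
    ring
  rw [h1, ← hsum.tsum_eq, finiteKernel]
  refine tsum_congr fun l => ?_
  rw [← sum_cauchyCoeff_mul_pow hc hq hq1 hc2 (x + l) (m + 1 + l) (by push_cast; omega),
    ← sum_cauchyCoeff_mul_pow hc hq hq1 hc2 (y + l) (n + 1 + l) (by push_cast; omega),
    Finset.sum_mul_sum]
  refine Finset.sum_congr rfl fun i _ => Finset.sum_congr rfl fun j _ => ?_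
  rw [mul_pow, pow_add, pow_add]
  ring

theorem tendsto_finiteKernel {ξ : ℝ} (hξ : 0 < ξ) (hξ1 : ξ < 1) (hq : 0 < q) (hq1 : q < 1)
    (x y : ℤ) : Tendsto (fun N => finiteKernel (ξ * √q) (ξ ^ 2) q N x y) atTop
      (𝓝 (kernelSeries ξ q (x + 1 / 2) (y + 1 / 2))) := by
  have hc := mul_sqrt_pos hξ hq
  have hc1 := mul_sqrt_lt_one hξ hξ1 hq1
  have hs : 0 < ξ ^ 2 := pow_pos hξ 2
  have hs1 : ξ ^ 2 < 1 := pow_lt_one₀ hξ.le hξ1 two_ne_zero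
  have hterm : ∀ (x : ℤ) (l : ℕ), Tendsto
      (fun N => (ξ * √q) ^ (x + 1 + l) * finiteSeries (ξ ^ 2) q N (q ^ (x + 1 + l))) atTop
      (𝓝 (scaledBessel ξ q ((x : ℝ) + 1 / 2 + 1 / 2 + l))) := by
    intro x l
    have e : (x : ℝ) + 1 / 2 + 1 / 2 + l = ((x + 1 + l : ℤ) : ℝ) := by push_cast; ring
    rw [e, scaledBessel, Real.rpow_intCast, Real.rpow_intCast]
    exact (tendsto_finiteSeries hq hq1 hs hs1 _).const_mul _
  have hbound : ∀ x : ℤ, ∃ B, 0 ≤ B ∧ ∀ (N l : ℕ),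
      |(ξ * √q) ^ (x + 1 + l) * finiteSeries (ξ ^ 2) q N (q ^ (x + 1 + l))| ≤
        B * (ξ * √q) ^ l := by
    intro x
    obtain ⟨B, hB, h⟩ := exists_finiteSeries_bound hq hq1 hs hs1 (q ^ (x + 1)) (by positivity)
    refine ⟨(ξ * √q) ^ (x + 1) * B, by positivity, fun N l => ?_⟩
    have h1 : |q ^ (x + 1 + l)| ≤ q ^ (x + 1) := by
      rw [abs_of_pos (zpow_pos hq _), zpow_add₀ hq.ne', zpow_natCast]
      exact mul_le_of_le_one_right (zpow_pos hq _).le (pow_le_one₀ hq.le hq1.le)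
    rw [abs_mul, abs_of_pos (zpow_pos hc _), zpow_add₀ hc.ne', zpow_natCast,
      mul_right_comm _ B]
    exact mul_le_mul_of_nonneg_left (h N _ h1) (by positivity)
  obtain ⟨B, hB, h⟩ := hbound x
  obtain ⟨B', hB', h'⟩ := hbound y
  refine tendsto_tsum_of_dominated_convergence (summable_geometric_mul_self hc hc1 B B')
    (fun l => (hterm x l).mul (hterm y l)) (Eventually.of_forall fun N l => ?_)
  rw [norm_mul]
  exact mul_le_mul (h N l) (h' N l) (norm_nonneg _) (by positivity)

end

/-! ### The normalization -/

/-- The MacMahon product for partitions with at most `N` rows. -/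
def finiteMacMahon (s q : ℝ) (N : ℕ) : ℝ :=
  ∏ i ∈ Finset.range N, ∏ j ∈ Finset.range N, (1 - s * q ^ (i + j + 1))⁻¹

/-- The product over ordered pairs is the squared Vandermonde determinant up to sign; squaring once
more removes the sign. -/
theorem prod_prod_erase_sq {N : ℕ} (a : Fin N → ℝ) :
    (∏ i, ∏ j ∈ Finset.univ.erase i, (a i - a j)) ^ 2 =
      (powDet a (fun j => (j : ℕ)) ^ 2) ^ 2 := by
  have hV : powDet a (fun j => (j : ℕ)) = ∏ i, ∏ j ∈ Finset.Ioi i, (a j - a i) :=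
    Matrix.det_vandermonde a
  have h1 : ∏ i, ∏ j ∈ Finset.univ.erase i, (a i - a j) =
      (∏ i, ∏ j ∈ Finset.Iio i, (a i - a j)) * ∏ i, ∏ j ∈ Finset.Ioi i, (a i - a j) := by
    rw [← Finset.prod_mul_distrib]
    refine Finset.prod_congr rfl fun i _ => ?_
    rw [← Finset.prod_union (Finset.disjoint_left.2 fun j hj hj' =>
      lt_asymm (Finset.mem_Iio.1 hj) (Finset.mem_Ioi.1 hj'))]
    refine Finset.prod_congr (Finset.ext fun j => ?_) fun _ _ => rfl
    simp [lt_or_lt_iff_ne]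
  have h2 : ∏ i, ∏ j ∈ Finset.Iio i, (a i - a j) = ∏ i, ∏ j ∈ Finset.Ioi i, (a j - a i) :=
    Finset.prod_comm' (by simp)
  have h3 : (∏ i, ∏ j ∈ Finset.Ioi i, (a i - a j)) ^ 2 =
      (∏ i, ∏ j ∈ Finset.Ioi i, (a j - a i)) ^ 2 := by
    simp only [← Finset.prod_pow]
    exact Finset.prod_congr rfl fun i _ => Finset.prod_congr rfl fun j _ => by ring
  rw [h1, h2, mul_pow, h3, hV]
  ring

section

variable {c s q : ℝ}

theorem powDet_geomParam_ne_zero (hc : 0 < c) (hq : 0 < q) (hq1 : q < 1) (N : ℕ) :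
    powDet (geomParam c q N) (fun j => (j : ℕ)) ≠ 0 :=
  Matrix.det_vandermonde_ne_zero_iff.2 (geomParam_injective hc hq hq1)

theorem cauchyGram_geomParam_mul (hc : 0 < c) (hc1 : c < 1) (hq : 0 < q) (hq1 : q < 1) (N : ℕ) :
    cauchyGram (geomParam c q N) * (Matrix.diagonal (cauchyCoeff (geomParam c q N)) *
      cauchyGram (geomParam c q N) * Matrix.diagonal (cauchyCoeff (geomParam c q N))) = 1 :=
  cauchyGram_mul _ (geomParam_injective hc hq hq1)
    (fun i => by simp only [geomParam]; positivity)
    (fun i j => (sub_pos.2 (geomParam_mul_lt_one hc hc1 hq hq1 i j)).ne')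

theorem abs_geomParam_mul_lt_one (hc : 0 < c) (hc1 : c < 1) (hq : 0 < q) (hq1 : q < 1) {N : ℕ}
    (i j : Fin N) : |geomParam c q N i * geomParam c q N j| < 1 := by
  rw [abs_of_pos (geomParam_mul_pos hc hq i j)]
  exact geomParam_mul_lt_one hc hc1 hq hq1 i j

/-- The Cauchy determinant. -/
theorem det_cauchyGram (hc : 0 < c) (hc1 : c < 1) (hq : 0 < q) (hq1 : q < 1)
    (hc2 : c ^ 2 = s * q) (N : ℕ) : Matrix.det (cauchyGram (geomParam c q N)) =
      powDet (geomParam c q N) (fun j => (j : ℕ)) ^ 2 * finiteMacMahon s q N := by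
  classical
  set a := geomParam c q N with ha
  set κ := powDet a (fun j => (j : ℕ)) ^ 2 with hκ
  have hκ0 : 0 < κ := sq_pos_of_ne_zero (powDet_geomParam_ne_zero hc hq hq1 N)
  have hpos : 0 ≤ Matrix.det (cauchyGram a) :=
    (hasSum_powDet_sq a (abs_geomParam_mul_lt_one hc hc1 hq hq1)).nonneg fun p => by
      split_ifs <;> positivity
  have hM : ∏ i, ∏ j, (1 - a i * a j) = (finiteMacMahon s q N)⁻¹ := by
    rw [finiteMacMahon, Finset.prod_range]
    simp only [Finset.prod_range, Finset.prod_inv_distrib, inv_inv]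
    refine Finset.prod_congr rfl fun i _ => Finset.prod_congr rfl fun j _ => ?_
    rw [ha, geomParam_mul hc2, pow_succ, pow_succ, pow_add]
    ring
  have hMpos : 0 < ∏ i, ∏ j, (1 - a i * a j) := Finset.prod_pos fun i _ =>
    Finset.prod_pos fun j _ => sub_pos.2 (geomParam_mul_lt_one hc hc1 hq hq1 i j)
  have hM0 : 0 < finiteMacMahon s q N := inv_pos.1 (hM ▸ hMpos)
  have h := congrArg Matrix.det (cauchyGram_geomParam_mul hc hc1 hq hq1 N)
  rw [Matrix.det_mul, Matrix.det_mul, Matrix.det_mul, Matrix.det_diagonal, Matrix.det_one,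
    ← ha] at h
  have hd : ∏ i, cauchyCoeff a i =
      (finiteMacMahon s q N)⁻¹ * (∏ i, ∏ j ∈ Finset.univ.erase i, (a i - a j))⁻¹ := by
    simp only [cauchyCoeff, Finset.prod_mul_distrib]
    rw [hM, Finset.prod_inv_distrib]
  rw [hd] at h
  have hsq := prod_prod_erase_sq a
  set P := ∏ i, ∏ j ∈ Finset.univ.erase i, (a i - a j) with hP
  have hP0 : P ≠ 0 := by
    intro h0
    rw [h0, ← hκ] at hsq
    have := pow_pos hκ0 2
    linarith [hsq, this, (by norm_num : (0 : ℝ) ^ 2 = 0)]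
  -- Taking determinants in `G D G D = 1` determines `det G` up to sign. The sign is fixed by
  -- `hpos`: `det G` is a sum of squares.
  have h2 : Matrix.det (cauchyGram a) ^ 2 = (κ * finiteMacMahon s q N) ^ 2 := by
    have hM1 := hM0.ne'
    field_simp at h
    rw [mul_pow, ← hsq]
    linear_combination h
  exact (pow_left_inj₀ hpos (mul_pos hκ0 hM0).le two_ne_zero).1 h2

end

/-! ### Convergence of the finite MacMahon products -/

theorem neg_log_one_sub_nonneg {x : ℝ} (hx0 : 0 ≤ x) (hx1 : x < 1) : 0 ≤ -Real.log (1 - x) :=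
  neg_nonneg.2 (Real.log_nonpos (by linarith) (by linarith))

theorem neg_log_one_sub_le {x s : ℝ} (hs1 : s < 1) (hx0 : 0 ≤ x) (hx1 : x ≤ s) :
    -Real.log (1 - x) ≤ x * (1 - s)⁻¹ := by
  have h1 : 0 < 1 - x := by linarith
  rw [← Real.log_inv]
  refine (Real.log_le_sub_one_of_pos (inv_pos.2 h1)).trans ?_
  have h2 : (1 - x)⁻¹ - 1 = x * (1 - x)⁻¹ := by field_simp; ring
  rw [h2]
  exact mul_le_mul_of_nonneg_left (inv_anti₀ (by linarith) (by linarith)) hx0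

/-- The square of side `N` contains the triangle `i + j < N` and lies in the triangle `i + j < 2 N`;
the antidiagonal `i + j = n` has `n + 1` points. -/
theorem sum_range_sq_bounds (L : ℕ → ℝ) (hL : ∀ n, 0 ≤ L n) (N : ℕ) :
    ∑ n ∈ Finset.range N, ((n : ℝ) + 1) * L n ≤
        ∑ p ∈ Finset.range N ×ˢ Finset.range N, L (p.1 + p.2) ∧
      ∑ p ∈ Finset.range N ×ˢ Finset.range N, L (p.1 + p.2) ≤
        ∑ n ∈ Finset.range (2 * N), ((n : ℝ) + 1) * L n := by
  have hcard : ∀ n : ℕ, ((n : ℝ) + 1) * L n = ∑ p ∈ Finset.HasAntidiagonal.antidiagonal n, L (p.1 + p.2) := by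
    intro n
    rw [Finset.sum_congr rfl fun p hp => by rw [Finset.HasAntidiagonal.mem_antidiagonal.1 hp],
      Finset.sum_const, Finset.Nat.card_antidiagonal, nsmul_eq_mul]
    push_cast
    rfl
  have hdisj : ∀ M : ℕ, (Finset.range M : Set ℕ).PairwiseDisjoint
      (fun n => Finset.HasAntidiagonal.antidiagonal n) := by
    intro M m _ n _ hmn
    refine Finset.disjoint_left.2 fun p hp hp' => hmn ?_
    rw [← Finset.HasAntidiagonal.mem_antidiagonal.1 hp, Finset.HasAntidiagonal.mem_antidiagonal.1 hp']
  simp only [hcard]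
  rw [← Finset.sum_biUnion (hdisj N), ← Finset.sum_biUnion (hdisj (2 * N))]
  refine ⟨Finset.sum_le_sum_of_subset_of_nonneg ?_ fun p _ _ => hL _,
    Finset.sum_le_sum_of_subset_of_nonneg ?_ fun p _ _ => hL _⟩
  · intro p hp
    simp only [Finset.mem_biUnion, Finset.mem_range, Finset.HasAntidiagonal.mem_antidiagonal,
      Finset.mem_product] at hp ⊢
    omega
  · intro p hp
    simp only [Finset.mem_biUnion, Finset.mem_range, Finset.HasAntidiagonal.mem_antidiagonal,
      Finset.mem_product] at hp ⊢
    exact ⟨_, by omega, rfl⟩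

/-- In logarithms, the exponent `n + 1` in the MacMahon product counts the pairs with `i + j = n`.
The sum over the square is squeezed between two partial sums of one convergent series. -/
theorem tendsto_finiteMacMahon {ξ q : ℝ} (hξ : 0 < ξ) (hξ1 : ξ < 1) (hq : 0 < q) (hq1 : q < 1) :
    Tendsto (finiteMacMahon (ξ ^ 2) q) atTop (𝓝 (macMahon ξ q)) := by
  set s := ξ ^ 2 with hs
  have hs0 : 0 < s := pow_pos hξ 2
  have hs1 : s < 1 := pow_lt_one₀ hξ.le hξ1 two_ne_zero
  set L : ℕ → ℝ := fun n => -Real.log (1 - s * q ^ (n + 1)) with hLdef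
  have hx0 : ∀ n : ℕ, 0 ≤ s * q ^ (n + 1) := fun n => by positivity
  have hxs : ∀ n : ℕ, s * q ^ (n + 1) ≤ s := fun n =>
    mul_le_of_le_one_right hs0.le (pow_le_one₀ hq.le hq1.le)
  have hpos : ∀ n : ℕ, 0 < 1 - s * q ^ (n + 1) := fun n => by linarith [hxs n]
  have hL : ∀ n, 0 ≤ L n := fun n => neg_log_one_sub_nonneg (hx0 n) ((hxs n).trans_lt hs1)
  have hsum : Summable fun n : ℕ => ((n : ℝ) + 1) * L n := by
    have h1 : Summable fun n : ℕ => ((n : ℝ) + 1) * q ^ (n + 1) := by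
      have := (summable_nat_add_iff 1).2 (summable_pow_mul_geometric_of_norm_lt_one 1
        (r := q) (by rwa [Real.norm_eq_abs, abs_of_pos hq]))
      simpa using this
    refine Summable.of_nonneg_of_le (fun n => mul_nonneg (by positivity) (hL n)) (fun n => ?_)
      (h1.mul_left (s * (1 - s)⁻¹))
    have := mul_le_mul_of_nonneg_left (neg_log_one_sub_le hs1 (hx0 n) (hxs n))
      (by positivity : (0 : ℝ) ≤ (n : ℝ) + 1)
    refine this.trans (le_of_eq ?_)
    ring
  have hlog : ∀ n : ℕ, Real.log (1 / (1 - s * q ^ (n + 1)) ^ (n + 1)) = ((n : ℝ) + 1) * L n := by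
    intro n
    rw [one_div, Real.log_inv, Real.log_pow, hLdef]
    push_cast
    ring
  have hfpos : ∀ n : ℕ, 0 < 1 / (1 - s * q ^ (n + 1)) ^ (n + 1) := fun n =>
    one_div_pos.2 (pow_pos (hpos n) _)
  have hmac : macMahon ξ q = Real.exp (∑' n : ℕ, ((n : ℝ) + 1) * L n) := by
    have := Real.rexp_tsum_eq_tprod hfpos (by simpa only [hlog] using hsum)
    simp only [hlog] at this
    exact this.symm
  have hfin : ∀ N, finiteMacMahon s q N =
      Real.exp (∑ p ∈ Finset.range N ×ˢ Finset.range N, L (p.1 + p.2)) := by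
    intro N
    rw [Real.exp_sum, Finset.prod_product, finiteMacMahon]
    refine Finset.prod_congr rfl fun i _ => Finset.prod_congr rfl fun j _ => ?_
    simp only [hLdef]
    rw [← Real.log_inv, Real.exp_log (inv_pos.2 (hpos _))]
  rw [hmac, funext hfin]
  refine (Real.continuous_exp.tendsto _).comp ?_
  have h1 := hsum.hasSum.tendsto_sum_nat
  have h2 : Tendsto (fun N => ∑ n ∈ Finset.range (2 * N), ((n : ℝ) + 1) * L n) atTop
      (𝓝 (∑' n : ℕ, ((n : ℝ) + 1) * L n)) :=
    h1.comp (tendsto_id.const_mul_atTop' two_pos)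
  exact tendsto_of_tendsto_of_tendsto_of_le_of_le h1 h2
    (fun N => (sum_range_sq_bounds L hL N).1) (fun N => (sum_range_sq_bounds L hL N).2)

/-! ### Convergence of the ensembles with `N` rows -/

theorem rawWeight_nonneg {ξ q : ℝ} (hq : 0 < q) (lam : YoungDiagram) : 0 ≤ rawWeight ξ q lam := by
  refine mul_nonneg (by positivity) (Finset.prod_nonneg fun x _ => ?_)
  positivity

/-- Since `(q; q)_n` decreases in `n` and `p_j ≥ j`, every factor is at most one. -/
theorem rowRatio_mem_Icc {q : ℝ} (hq : 0 < q) (hq1 : q < 1) (N : ℕ) (lam : YoungDiagram) :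
    0 ≤ rowRatio q N lam ∧ rowRatio q N lam ≤ 1 := by
  refine ⟨Finset.prod_nonneg fun j _ => sq_nonneg _, Finset.prod_le_one (fun j _ => sq_nonneg _)
    fun j _ => ?_⟩
  have h0 := qPoch_self_pos hq hq1 j
  have h1 := qPoch_self_pos hq hq1 (shiftedRows N lam j)
  refine pow_le_one₀ (div_nonneg h1.le h0.le) ((div_le_one h0).2 ?_)
  exact qPoch_antitone hq hq1 hq.le hq1.le (Nat.le_add_left _ _)

/-- Empty rows contribute the factor one, so only `lam.colLen 0` factors matter, a number
independent of `N`. In each of them numerator and denominator tend to `(q; q)_∞`. -/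
theorem tendsto_rowRatio {q : ℝ} (hq : 0 < q) (hq1 : q < 1) (lam : YoungDiagram) :
    Tendsto (fun N => rowRatio q N lam) atTop (𝓝 1) := by
  have hQ := (qPochInf_pos hq hq1 hq1).ne'
  have hlim : ∀ i r : ℕ, Tendsto (fun N => qPoch q q (r + (N - 1 - i))) atTop
      (𝓝 (qPochInf q q)) := by
    intro i r
    refine (tendsto_qPoch hq hq1 q).comp (tendsto_atTop.2 fun b => ?_)
    filter_upwards [eventually_ge_atTop (b + 1 + i)] with N hN
    omega
  have h1 : Tendsto (fun N => ∏ i ∈ Finset.range (lam.colLen 0),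
      (qPoch q q (lam.rowLen i + (N - 1 - i)) / qPoch q q (0 + (N - 1 - i))) ^ 2) atTop
      (𝓝 (∏ i ∈ Finset.range (lam.colLen 0), (qPochInf q q / qPochInf q q) ^ 2)) :=
    tendsto_finsetProd _ fun i _ => ((hlim i _).div (hlim i 0) hQ).pow 2
  simp only [div_self hQ, one_pow, Finset.prod_const_one] at h1
  refine h1.congr' ?_
  filter_upwards [eventually_ge_atTop (lam.colLen 0)] with N hN
  have h2 : rowRatio q N lam = ∏ i ∈ Finset.range N,
      (qPoch q q (lam.rowLen i + (N - 1 - i)) / qPoch q q (0 + (N - 1 - i))) ^ 2 := by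
    rw [Finset.prod_range, ← Equiv.prod_comp Fin.revPerm, rowRatio]
    refine Finset.prod_congr rfl fun j _ => ?_
    have e : N - 1 - (Fin.rev j : ℕ) = j := by simp only [Fin.val_rev]; omega
    rw [Fin.revPerm_apply, e, zero_add, shiftedRows]
  rw [h2]
  refine Finset.prod_subset (Finset.range_mono hN) fun i _ hi => ?_
  rw [rowLen_eq_zero (by simpa using hi), div_self (qPoch_self_pos hq hq1 _).ne', one_pow]

theorem range_subset_config_iff {N k : ℕ} {lam : YoungDiagram} (hN : lam.colLen 0 ≤ N)
    (z : Fin k → ℤ) (x : Fin k → ℕ) (hx : ∀ i, (x i : ℤ) = z i + N) :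
    Set.range (fun i => (z i : ℝ) + 1 / 2) ⊆ config lam ↔
      Set.range x ⊆ Set.range (shiftedRows N lam) := by
  rw [Set.range_subset_iff, Set.range_subset_iff]
  refine forall_congr' fun i => ?_
  constructor
  · rintro ⟨r, hr⟩
    have hz : z i = lam.rowLen r - (r + 1) := by
      have h : (z i : ℝ) = ((lam.rowLen r - (r + 1) : ℤ) : ℝ) := by push_cast; linarith
      exact_mod_cast h
    have hxi := hx i
    -- A row `r ≥ N` is empty and gives the point `-(r + 1) < -N`, which the shift by `N` leaves
    -- negative, whereas `x i` is a natural number.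
    have hrN : r < N := by
      by_contra hcon
      have := rowLen_eq_zero (hN.trans (not_lt.1 hcon))
      omega
    refine ⟨Fin.rev ⟨r, hrN⟩, ?_⟩
    rw [shiftedRows, Fin.rev_rev, Fin.val_rev]
    simp only
    omega
  · rintro ⟨j, hj⟩
    refine ⟨j.rev, ?_⟩
    have hxi := hx i
    have hz : z i = lam.rowLen j.rev - ((j.rev : ℕ) + 1) := by
      rw [shiftedRows] at hj
      have := Fin.val_rev j
      omega
    rw [hz]
    push_cast
    ring

-- The determinantal formula for squared determinants, carried over to diagrams and divided by the
-- squared determinant `κ` of the empty partition. `N` must be large enough that the shifted points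
-- are natural numbers.
open Classical in
theorem hasSum_rawWeight_rowRatio {ξ q : ℝ} (hξ : 0 < ξ) (hξ1 : ξ < 1) (hq : 0 < q) (hq1 : q < 1)
    {N k : ℕ} (z : Fin k → ℤ) (hz : Function.Injective z) (hzN : ∀ i, 0 ≤ z i + N) :
    HasSum (fun lam : YoungDiagram =>
        if lam.colLen 0 ≤ N ∧ Set.range (fun i => (z i : ℝ) + 1 / 2) ⊆ config lam then
          rawWeight ξ q lam * rowRatio q N lam else 0)
      (finiteMacMahon (ξ ^ 2) q N * Matrix.det (Matrix.of fun i j : Fin k =>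
        finiteKernel (ξ * √q) (ξ ^ 2) q N (z i) (z j))) := by
  have hc := mul_sqrt_pos hξ hq
  have hc1 := mul_sqrt_lt_one hξ hξ1 hq1
  have hc2 : (ξ * √q) ^ 2 = ξ ^ 2 * q := by rw [mul_pow, Real.sq_sqrt hq.le]
  set c := ξ * √q with hcdef
  set κ := powDet (geomParam c q N) (fun j => (j : ℕ)) ^ 2 with hκ
  have hκ0 : κ ≠ 0 := pow_ne_zero 2 (powDet_geomParam_ne_zero hc hq hq1 N)
  let x : Fin k → ℕ := fun i => (z i + N).toNat
  have hx : ∀ i, (x i : ℤ) = z i + N := fun i => Int.toNat_of_nonneg (hzN i)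
  have hxinj : Function.Injective x := by
    intro i j hij
    refine hz ?_
    have h1 := hx i
    have h2 := hx j
    rw [hij] at h1
    omega
  have h := (hasSum_powDet_sq_of_range_subset (geomParam c q N)
    (abs_geomParam_mul_lt_one hc hc1 hq hq1) _ (cauchyGram_geomParam_mul hc hc1 hq hq1 N)
    x hxinj).mul_left κ⁻¹
  have hK : (Matrix.of fun i j : Fin k => ∑ l, ∑ m, geomParam c q N l ^ x i *
      (Matrix.diagonal (cauchyCoeff (geomParam c q N)) * cauchyGram (geomParam c q N) *
        Matrix.diagonal (cauchyCoeff (geomParam c q N)) : Matrix (Fin N) (Fin N) ℝ) l m *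
          geomParam c q N m ^ x j) =
      Matrix.of fun i j : Fin k => finiteKernel c (ξ ^ 2) q N (z i) (z j) := by
    ext i j
    exact sum_cauchyGram_inv hc hc1 hq hq1 hc2 _ _ _ _ (hx i) (hx j)
  rw [hK, det_cauchyGram hc hc1 hq hq1 hc2, ← hκ, ← mul_assoc, ← mul_assoc,
    inv_mul_cancel₀ hκ0, one_mul] at h
  refine hasSum_youngDiagram (fun lam hl => if_neg fun h => hl h.1) (fun p hp => ?_)
    (fun lam hl => ?_) h
  · simp [hp]
  · rw [range_subset_config_iff hl z x hx]
    have hsq := powDet_sq_shiftedRows (c := c) hc2 hq hq1 hl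
    by_cases hsub : Set.range x ⊆ Set.range (shiftedRows N lam)
    · rw [if_pos ⟨hl, hsub⟩, if_pos ⟨strictMono_shiftedRows N lam, hsub⟩]
      change powDet (geomParam c q N) (shiftedRows N lam) ^ 2 = κ * _ at hsq
      rw [hsq, inv_mul_cancel_left₀ hκ0]
    · rw [if_neg fun h => hsub h.2, if_neg fun h => hsub h.2, mul_zero]

theorem tendsto_rowRatio_ite {q : ℝ} (hq : 0 < q) (hq1 : q < 1) (lam : YoungDiagram) (P : Prop)
    [Decidable P] (w : ℝ) [∀ N, Decidable (lam.colLen 0 ≤ N ∧ P)] :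
    Tendsto (fun N => if lam.colLen 0 ≤ N ∧ P then w * rowRatio q N lam else 0) atTop
      (𝓝 (if P then w else 0)) := by
  by_cases hP : P
  · rw [if_pos hP]
    have h := (tendsto_rowRatio hq hq1 lam).const_mul w
    rw [mul_one] at h
    refine h.congr' ?_
    filter_upwards [eventually_ge_atTop (lam.colLen 0)] with N hN
    rw [if_pos ⟨hN, hP⟩]
  · simp [hP]

-- A sum over a finite set of diagrams is the limit of its `N`-row versions. Each of these is at
-- most the total `N`-row mass `finiteMacMahon`, the case `k = 0`, which tends to `macMahon`.
open Classical in
theorem summable_rawWeight {ξ q : ℝ} (hξ : 0 < ξ) (hξ1 : ξ < 1) (hq : 0 < q) (hq1 : q < 1) :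
    Summable (rawWeight ξ q) := by
  refine summable_of_sum_le (rawWeight_nonneg hq) (c := macMahon ξ q) fun T => ?_
  have hlim : Tendsto (fun N => ∑ lam ∈ T,
      if lam.colLen 0 ≤ N ∧ True then rawWeight ξ q lam * rowRatio q N lam else 0) atTop
      (𝓝 (∑ lam ∈ T, if True then rawWeight ξ q lam else 0)) :=
    tendsto_finsetSum _ fun lam _ => tendsto_rowRatio_ite hq hq1 lam True _
  simp only [if_true] at hlim
  refine le_of_tendsto_of_tendsto' hlim (tendsto_finiteMacMahon hξ hξ1 hq hq1) fun N => ?_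
  have h := hasSum_rawWeight_rowRatio hξ hξ1 hq hq1 (N := N) (k := 0) Fin.elim0
    (fun i => i.elim0) (fun i => i.elim0)
  rw [Matrix.det_isEmpty, mul_one] at h
  have h0 : ∀ lam : YoungDiagram, Set.range (fun i : Fin 0 =>
      ((Fin.elim0 i : ℤ) : ℝ) + 1 / 2) ⊆ config lam := fun lam => by
    rw [Set.range_eq_empty]; exact Set.empty_subset _
  simp only [h0] at h
  refine sum_le_hasSum T (fun lam _ => ?_) h
  split_ifs
  · exact mul_nonneg (rawWeight_nonneg hq lam) (rowRatio_mem_Icc hq hq1 N lam).1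
  · exact le_rfl

-- The limit `N → ∞` of `hasSum_rawWeight_rowRatio`. On the left the unnormalized weights dominate
-- because `rowRatio` is at most one; on the right the entries of the determinant converge.
open Classical in
theorem hasSum_rawWeight_config {ξ q : ℝ} (hξ : 0 < ξ) (hξ1 : ξ < 1) (hq : 0 < q) (hq1 : q < 1)
    {k : ℕ} (z : Fin k → ℤ) (hz : Function.Injective z) :
    HasSum (fun lam : YoungDiagram =>
        if Set.range (fun i => (z i : ℝ) + 1 / 2) ⊆ config lam then rawWeight ξ q lam else 0)
      (macMahon ξ q * Matrix.det (Matrix.of fun i j : Fin k =>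
        qBesselKernel ξ q (z i + 1 / 2) (z j + 1 / 2))) := by
  have hs := summable_rawWeight hξ hξ1 hq hq1
  have h1 : Tendsto (fun N => ∑' lam : YoungDiagram,
      if lam.colLen 0 ≤ N ∧ Set.range (fun i => (z i : ℝ) + 1 / 2) ⊆ config lam then
          rawWeight ξ q lam * rowRatio q N lam else 0) atTop
      (𝓝 (∑' lam : YoungDiagram,
        if Set.range (fun i => (z i : ℝ) + 1 / 2) ⊆ config lam then rawWeight ξ q lam else 0)) := by
    refine tendsto_tsum_of_dominated_convergence hs
      (fun lam => tendsto_rowRatio_ite hq hq1 lam _ _) (Eventually.of_forall fun N lam => ?_)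
    have hw := rawWeight_nonneg (ξ := ξ) hq lam
    have hr := rowRatio_mem_Icc hq hq1 N lam
    split_ifs
    · rw [Real.norm_eq_abs, abs_of_nonneg (mul_nonneg hw hr.1)]
      exact mul_le_of_le_one_right hw hr.2
    · rwa [norm_zero]
  have h2 : Tendsto (fun N => finiteMacMahon (ξ ^ 2) q N * Matrix.det (Matrix.of fun i j : Fin k =>
        finiteKernel (ξ * √q) (ξ ^ 2) q N (z i) (z j))) atTop
      (𝓝 (macMahon ξ q * Matrix.det (Matrix.of fun i j : Fin k =>
        qBesselKernel ξ q (z i + 1 / 2) (z j + 1 / 2)))) := by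
    refine (tendsto_finiteMacMahon hξ hξ1 hq hq1).mul ?_
    have hcont : Continuous fun M : Matrix (Fin k) (Fin k) ℝ => M.det := continuous_id.matrix_det
    refine (hcont.tendsto _).comp (tendsto_pi_nhds.2 fun i => tendsto_pi_nhds.2 fun j => ?_)
    simp only [Matrix.of_apply, qBesselKernel_eq_kernelSeries hξ hξ1 hq hq1]
    exact tendsto_finiteKernel hξ hξ1 hq hq1 (z i) (z j)
  have h3 : ∀ᶠ N : ℕ in atTop, ∀ i, 0 ≤ z i + N := by
    refine eventually_all.2 fun i => ?_
    filter_upwards [eventually_ge_atTop (z i).natAbs] with N hN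
    omega
  have h4 := h1.congr' (h3.mono fun N hN =>
    (hasSum_rawWeight_rowRatio hξ hξ1 hq hq1 z hz hN).tsum_eq)
  rw [tendsto_nhds_unique h2 h4]
  refine (Summable.of_nonneg_of_le (fun lam => ?_) (fun lam => ?_) hs).hasSum
  · split_ifs
    · exact rawWeight_nonneg hq lam
    · exact le_rfl
  · split_ifs
    · exact le_rfl
    · exact rawWeight_nonneg hq lam

theorem hasSum_rawWeight {ξ q : ℝ} (hξ : 0 < ξ) (hξ1 : ξ < 1) (hq : 0 < q) (hq1 : q < 1) :
    HasSum (rawWeight ξ q) (macMahon ξ q) := by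
  have h := hasSum_rawWeight_config hξ hξ1 hq hq1 (k := 0) Fin.elim0 (fun i => i.elim0)
  rw [Matrix.det_isEmpty, mul_one] at h
  refine HasSum.congr_fun h fun lam => ?_
  rw [if_pos]
  rw [Set.range_eq_empty]
  exact Set.empty_subset _

/-- The empty partition alone contributes `1` to the sum. -/
theorem macMahon_pos {ξ q : ℝ} (hξ : 0 < ξ) (hξ1 : ξ < 1) (hq : 0 < q) (hq1 : q < 1) :
    0 < macMahon ξ q := by
  have h := le_hasSum (hasSum_rawWeight hξ hξ1 hq hq1) ⊥ fun lam _ => rawWeight_nonneg hq lam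
  refine lt_of_lt_of_le ?_ h
  rw [rawWeight, YoungDiagram.cells_bot, Finset.prod_empty, mul_one]
  positivity

theorem weight_eq (ξ q : ℝ) (lam : YoungDiagram) :
    weight ξ q lam = (macMahon ξ q)⁻¹ * rawWeight ξ q lam := by
  rw [weight, rawWeight]
  ring

theorem measureS_apply_eq {ξ q x : ℝ} (hw : ∀ lam, 0 ≤ weight ξ q lam) (S : Set YoungDiagram)
    [DecidablePred fun lam => lam ∈ S]
    (h : HasSum (fun lam => if lam ∈ S then weight ξ q lam else 0) x) :
    measureS ξ q S = ENNReal.ofReal x := by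
  have hS : MeasurableSet S := trivial
  rw [measureS, Measure.sum_apply _ hS, ← h.tsum_eq, ENNReal.ofReal_tsum_of_nonneg _ h.summable]
  · refine tsum_congr fun lam => ?_
    rw [Measure.smul_apply, Measure.dirac_apply' _ hS]
    by_cases hl : lam ∈ S <;> simp [hl]
  · intro lam
    split_ifs
    · exact hw lam
    · exact le_rfl

end QPlancherel

end

/-! ### Total mass, diagonal limits and correlation functions -/

theorem theorem2 (ξ q : ℝ) (hξ : 0 < ξ) (hξ1 : ξ < 1) (hq : 0 < q) (hq1 : q < 1) :
    -- the squared type `q`-Plancherel measure is a probability measure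
    IsProbabilityMeasure (QPlancherel.measureS ξ q) ∧
    -- the limits that give the diagonal values of the kernel exist
    (∀ r ∈ QPlancherel.halfIntegers,
      Tendsto (fun u : ℝ => QPlancherel.kernelQuotient ξ q r u) (𝓝[≠] r)
        (𝓝 (QPlancherel.qBesselKernel ξ q r r))) ∧
    -- all correlation functions are determinants of the `q`-Bessel kernel
    (∀ (k : ℕ) (z : Fin k → ℝ), (∀ i, z i ∈ QPlancherel.halfIntegers) → Function.Injective z →
      QPlancherel.correlation (QPlancherel.measureS ξ q) (Set.range z) =
        Matrix.det (Matrix.of fun i j : Fin k => QPlancherel.qBesselKernel ξ q (z i) (z j))) := by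
  classical
  have hM := QPlancherel.macMahon_pos hξ hξ1 hq hq1
  have hw : ∀ lam, 0 ≤ QPlancherel.weight ξ q lam := fun lam => by
    rw [QPlancherel.weight_eq]
    exact mul_nonneg (inv_pos.2 hM).le (QPlancherel.rawWeight_nonneg hq lam)
  refine ⟨⟨?_⟩, fun r _ => ?_, fun k z hz hinj => ?_⟩
  · rw [QPlancherel.measureS_apply_eq hw Set.univ (x := 1), ENNReal.ofReal_one]
    have h := (QPlancherel.hasSum_rawWeight hξ hξ1 hq hq1).mul_left (QPlancherel.macMahon ξ q)⁻¹
    rw [inv_mul_cancel₀ hM.ne'] at h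
    refine HasSum.congr_fun h fun lam => ?_
    rw [if_pos (Set.mem_univ lam), QPlancherel.weight_eq]
  · rw [QPlancherel.qBesselKernel_eq_kernelSeries hξ hξ1 hq hq1]
    exact QPlancherel.tendsto_kernelQuotient hξ hξ1 hq hq1 r
  · choose n hn using hz
    obtain rfl : z = fun i => (n i : ℝ) + 1 / 2 := funext hn
    have hninj : Function.Injective n := fun i j hij => hinj (by simp only [hij])
    have h := (QPlancherel.hasSum_rawWeight_config hξ hξ1 hq hq1 n hninj).mul_left
      (QPlancherel.macMahon ξ q)⁻¹
    rw [inv_mul_cancel_left₀ hM.ne'] at h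
    have h2 : HasSum (fun lam : YoungDiagram =>
        if lam ∈ {lam | Set.range (fun i => (n i : ℝ) + 1 / 2) ⊆ QPlancherel.config lam} then
          QPlancherel.weight ξ q lam else 0)
        (Matrix.det (Matrix.of fun i j : Fin k =>
          QPlancherel.qBesselKernel ξ q (n i + 1 / 2) (n j + 1 / 2))) := by
      refine HasSum.congr_fun h fun lam => ?_
      rw [QPlancherel.weight_eq, mul_ite, mul_zero]
      rfl
    rw [QPlancherel.correlation, Measure.real, QPlancherel.measureS_apply_eq hw _ h2,
      ENNReal.toReal_ofReal]
    refine h2.nonneg fun lam => ?_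
    split_ifs
    · exact hw lam
    · exact le_rfl
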